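/- \textbf{Proposition (Self-adjointness of the Nelson Hamiltonian).} Let $d\ge 1$, $n\in\mathbb N$, $\hbar>0$, $m_f>0$ and $M_1,\dots,M_n>0$. Put $\omega(k)=\sqrt{|k|^2+m_f^2}$ for $k\in\mathbb R^d$, and for each $j\in\{1,\dots,n\}$ let $f_j:\mathbb R^d\to\mathbb R$ be either $f_j(p)=\sqrt{|p|^2+M_j^2}$ (semi-relativistic case) or $f_j(p)=|p|^2/(2M_j)$ (non-relativistic case). Let $\mathcal H=L^2(\mathbb R^{dn},\mathbb C)\otimes\Gamma_s(L^2(\mathbb R^d,\mathbb C))$, where $\Gamma_s(L^2(\mathbb R^d,\mathbb C))=\bigoplus_{m\ge0}L^2_s(\mathbb R^{dm},\mathbb C)$ is the symmetric Fock space; write $\psi=\{\psi^m\}_{m\ge0}\in\mathcal H$ with $\psi^m=\psi^m(X;k_1,\dots,k_m)$, $X=(x_1,\dots,x_n)\in\mathbb R^{dn}$. Let $V:\mathbb R^{dn}\to\mathbb R$ and $\chi:\mathbb R^d\to\mathbb R$. Consider the following operators in $\mathcal H$, each on its maximal domain: \begin{itemize} \item $f_j(\hat p_j)$ with $\hat p_j=-i\hbar\nabla_{x_j}$,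 defined through the Fourier transform in $X$, and $V(\hat q)$, multiplication by $V(X)$; \item $[d\Gamma(\omega)\psi]^m(X;k_1,\dots,k_m)=\hbar\sum_{j=1}^m\omega(k_j)\,\psi^m(X;k_1,\dots,k_m)$; \item with $G_X(k)=\sum_{j=1}^n\frac{\chi(k)}{\sqrt{\omega(k)}}e^{-2\pi i k\cdot x_j}$, \[[\hat a_\hbar(G)\psi]^m(X;k_1,\dots,k_m)=\sqrt{\hbar(m+1)}\int_{\mathbb R^d}\overline{G_X(k)}\,\psi^{m+1}(X;k_1,\dots,k_m,k)\,dk ,\] \[[\hat a^*_\hbar(G)\psi]^m(X;k_1,\dots,k_m)=\frac{\sqrt\hbar}{\sqrt m}\sum_{j=1}^m G_X(k_j)\,\psi^{m-1}(X;k_1,\dots,\hat k_j,\dots,k_m)\] (equal to $0$ for $m=0$; $\hat k_j$ means that $k_j$ is omitted). \end{itemize} Sums of operators are defined on the intersection of the domains. Let $\hat H_{01}=\sum_{j=1}^n f_j(\hat p_j)$, $\hat H_{02}=d\Gamma(\omega)$, $\hat H_0=\hat H_{01}+\hat H_{02}$, $\hat H_1=\hat a_\hbar(G)+\hat a^*_\hbar(G)$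 and \[\hat H=\hat H_0+V(\hat q)+\hat H_1 .\] Assume that $V\in\mathcal C^2_b(\mathbb R^{dn};\mathbb R)$ (that is, $V$ is $C^2$ and $V$ and its derivatives of order at most two are bounded) and that $\omega^{-1/2}\chi\in L^2(\mathbb R^d)$. Then $\hat H$ is self-adjoint, and its domain is $D(\hat H)=D(\hat H_0)=D(\hat H_{01})\cap D(\hat H_{02})$. -/

import Mathlib

open MeasureTheory
open scoped ComplexConjugate InnerProductSpace FourierTransform

noncomputable section

namespace Nelson

/-! ### Partially defined operators given by their graphs and by their fibres -/

/-- The graph of the decomposable operator with fibres `A x` on `L²(X; F)`: pairs `(ψ, φ)` such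
that for almost every `x` one has `ψ x ∈ D(A x)` and `A x (ψ x) = φ x`. -/
def fibreGraph {X F : Type*} [MeasurableSpace X] {μ : Measure X}
    [NormedAddCommGroup F] [InnerProductSpace ℂ F] (A : X → F →ₗ.[ℂ] F) :
    Submodule ℂ (Lp F 2 μ × Lp F 2 μ) where
  carrier := {p | ∀ᵐ x ∂μ, (p.1 x, p.2 x) ∈ (A x).graph}
  add_mem' := by
    rintro ⟨a, b⟩ ⟨a', b'⟩ h h'
    filter_upwards [h, h', Lp.coeFn_add a a', Lp.coeFn_add b b'] with x hx hx' h1 h2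
    have := (A x).graph.add_mem hx hx'
    rwa [Prod.mk_add_mk, ← Pi.add_apply, ← Pi.add_apply, ← h1, ← h2] at this
  zero_mem' := by
    filter_upwards [Lp.coeFn_zero F 2 μ] with x h1
    change ((0 : Lp F 2 μ) x, (0 : Lp F 2 μ) x) ∈ (A x).graph
    rw [h1]
    exact (A x).graph.zero_mem
  smul_mem' := by
    rintro c ⟨a, b⟩ h
    filter_upwards [h, Lp.coeFn_smul c a, Lp.coeFn_smul c b] with x hx h1 h2
    have := (A x).graph.smul_mem c hx
    rw [Pi.smul_apply] at h1 h2
    rwa [Prod.smul_mk, ← h1, ← h2] at this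

/-- The operator `(A ψ)(x) = A x (ψ x)` on `L²(X; F)` with its maximal domain. -/
def fibreOp {X F : Type*} [MeasurableSpace X] (μ : Measure X)
    [NormedAddCommGroup F] [InnerProductSpace ℂ F] (A : X → F →ₗ.[ℂ] F) :
    Lp F 2 μ →ₗ.[ℂ] Lp F 2 μ :=
  (fibreGraph (μ := μ) A).toLinearPMap

/-- `fibreOp` really has the graph from which it is defined. -/
theorem graph_fibreOp {X F : Type*} [MeasurableSpace X] (μ : Measure X)
    [NormedAddCommGroup F] [InnerProductSpace ℂ F] (A : X → F →ₗ.[ℂ] F) :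
    (fibreOp μ A).graph = fibreGraph (μ := μ) A := by
  refine Submodule.toLinearPMap_graph_eq _ ?_
  rintro ⟨a, b⟩ h h0
  have h0' : a = 0 := h0
  subst h0'
  apply Lp.ext
  filter_upwards [h, Lp.coeFn_zero F 2 μ] with x hx h1
  rw [h1] at hx ⊢
  exact LinearPMap.graph_fst_eq_zero_snd (A x) hx rfl

/-- Multiplication of an `F`-valued square integrable function by the real function `h`, with its
maximal domain. -/
def mulOp {X F : Type*} [MeasurableSpace X] (μ : Measure X)
    [NormedAddCommGroup F] [InnerProductSpace ℂ F] (h : X → ℝ) : Lp F 2 μ →ₗ.[ℂ] Lp F 2 μ :=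
  fibreOp μ fun x => ((h x : ℂ) • (LinearMap.id : F →ₗ[ℂ] F)).toPMap ⊤

/-- The conjugate `U⁻¹ A U`, with domain `U⁻¹ D(A)`. -/
def conjOp {F : Type*} [NormedAddCommGroup F] [InnerProductSpace ℂ F]
    (U : F ≃ₗᵢ[ℂ] F) (A : F →ₗ.[ℂ] F) : F →ₗ.[ℂ] F where
  domain := A.domain.comap (U.toLinearEquiv : F →ₗ[ℂ] F)
  toFun := (U.symm.toLinearEquiv : F →ₗ[ℂ] F) ∘ₗ A.toFun ∘ₗ
    ((U.toLinearEquiv : F →ₗ[ℂ] F).restrict fun _ hx => hx)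

/-! ### The bosonic Fock space over `L²(ℝᵈ)` -/

/-- The space `ℝᵈ`. -/
abbrev Space (d : ℕ) := EuclideanSpace ℝ (Fin d)

/-- Permutations of the `m` momentum variables preserve Lebesgue measure. -/
theorem measurePreserving_perm (d m : ℕ) (σ : Equiv.Perm (Fin m)) :
    MeasurePreserving (fun K : Fin m → Space d => K ∘ σ) volume volume := by
  have h := volume_measurePreserving_piCongrLeft (fun _ : Fin m => Space d) σ.symm
  convert h using 1
  funext K i
  have := MeasurableEquiv.piCongrLeft_apply_apply (β := fun _ : Fin m => Space d) σ.symm K (σ i)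
  simpa using this.symm

/-- `L²_s(ℝ^{dm})`: the square integrable functions of `(k₁, …, kₘ)` that are invariant under all
permutations of the `m` variables. -/
def symL2 (d m : ℕ) : Submodule ℂ (Lp ℂ 2 (volume : Measure (Fin m → Space d))) :=
  ⨅ σ : Equiv.Perm (Fin m), LinearMap.eqLocus
    (Lp.compMeasurePreservingₗᵢ ℂ (fun K : Fin m → Space d => K ∘ σ)
      (measurePreserving_perm d m σ)).toLinearMap LinearMap.id

instance (d m : ℕ) : CompleteSpace (symL2 d m) := by
  have hc : IsClosed (symL2 d m : Set (Lp ℂ 2 (volume : Measure (Fin m → Space d)))) := by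
    rw [symL2, Submodule.coe_iInf]
    exact isClosed_iInter fun σ => isClosed_eq
      (Lp.compMeasurePreservingₗᵢ ℂ (fun K : Fin m → Space d => K ∘ σ)
        (measurePreserving_perm d m σ)).continuous continuous_id
  exact hc.completeSpace_coe

/-- The symmetric Fock space `⨁ₘ L²_s(ℝ^{dm})` (Hilbert sum). -/
def Fock (d : ℕ) : Type := lp (fun m : ℕ => symL2 d m) 2

instance (d : ℕ) : NormedAddCommGroup (Fock d) :=
  inferInstanceAs (NormedAddCommGroup (lp (fun m : ℕ => symL2 d m) 2))

instance (d : ℕ) : InnerProductSpace ℂ (Fock d) :=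
  inferInstanceAs (InnerProductSpace ℂ (lp (fun m : ℕ => symL2 d m) 2))

instance (d : ℕ) : CompleteSpace (Fock d) :=
  inferInstanceAs (CompleteSpace (lp (fun m : ℕ => symL2 d m) 2))

/-- A Fock vector as the sequence of its components (the identity map). -/
def Fock.components (d : ℕ) : Fock d ≃ₗᵢ[ℂ] lp (fun m : ℕ => symL2 d m) 2 :=
  LinearIsometryEquiv.refl ℂ (lp (fun m : ℕ => symL2 d m) 2)

/-- The `m`-particle component of a Fock vector, as a function of `(k₁, …, kₘ)`. -/
def comp {d : ℕ} (ψ : Fock d) (m : ℕ) : (Fin m → Space d) → ℂ :=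
  ((Fock.components d ψ m : symL2 d m) : Lp ℂ 2 (volume : Measure (Fin m → Space d)))

theorem comp_zero {d : ℕ} (m : ℕ) : comp (0 : Fock d) m =ᵐ[volume] 0 := by
  rw [comp, map_zero]
  exact Lp.coeFn_zero ℂ 2 _

theorem comp_add {d : ℕ} (ψ φ : Fock d) (m : ℕ) :
    comp (ψ + φ) m =ᵐ[volume] comp ψ m + comp φ m := by
  rw [comp, map_add]
  exact Lp.coeFn_add _ _

theorem comp_smul {d : ℕ} (c : ℂ) (ψ : Fock d) (m : ℕ) :
    comp (c • ψ) m =ᵐ[volume] c • comp ψ m := by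
  rw [comp, map_smul]
  exact Lp.coeFn_smul c _

theorem comp_ext {d : ℕ} {ψ φ : Fock d} (h : ∀ m, comp ψ m =ᵐ[volume] comp φ m) : ψ = φ := by
  apply (Fock.components d).injective
  apply lp.ext
  funext m
  exact Subtype.ext (Lp.ext (h m))

/-- An almost everywhere property of `(k₁, …, kₘ)` also holds at `(k₁, …, k̂ⱼ, …, kₘ₊₁)` for almost
every `(k₁, …, kₘ₊₁)`. -/
theorem ae_removeNth {d m : ℕ} (j : Fin (m + 1)) {p : (Fin m → Space d) → Prop}
    (h : ∀ᵐ K, p K) : ∀ᵐ K : Fin (m + 1) → Space d, p (j.removeNth K) := by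
  have h1 := volume_preserving_piFinSuccAbove (fun _ : Fin (m + 1) => Space d) j
  exact (Measure.quasiMeasurePreserving_snd.comp h1.quasiMeasurePreserving).ae h

/-- An almost everywhere property of `(k₁, …, kₘ, k)` holds, for almost every `(k₁, …, kₘ)`, for
almost every `k`. -/
theorem ae_snoc {d m : ℕ} {p : (Fin (m + 1) → Space d) → Prop} (h : ∀ᵐ K, p K) :
    ∀ᵐ K : Fin m → Space d, ∀ᵐ k : Space d, p (Fin.snoc K k) := by
  have h1 := (volume_preserving_piFinSuccAbove (fun _ : Fin (m + 1) => Space d)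
    (Fin.last m)).symm
  have h2 : ∀ᵐ z : Space d × (Fin m → Space d),
      p ((MeasurableEquiv.piFinSuccAbove (fun _ => Space d) (Fin.last m)).symm z) :=
    h1.quasiMeasurePreserving.ae h
  have h3 : ∀ᵐ z : (Fin m → Space d) × Space d, p (Fin.snoc z.1 z.2) := by
    have := (Measure.measurePreserving_swap (μ := (volume : Measure (Fin m → Space d)))
      (ν := (volume : Measure (Space d)))).quasiMeasurePreserving.ae h2
    filter_upwards [this] with z hz
    simpa [MeasurableEquiv.piFinSuccAbove, Fin.insertNthEquiv, Fin.insertNth_last'] using hz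
  exact Measure.ae_ae_of_ae_prod h3

/-! ### Free field energy, annihilation and creation operators on the Fock space -/

/-- Graph of `dΓ(w)`: pairs `(ψ, φ)` with
`φᵐ(k₁, …, kₘ) = ħ ∑ⱼ w(kⱼ) ψᵐ(k₁, …, kₘ)` for all `m`. -/
def secondQuantGraph {d : ℕ} (ħ : ℝ) (w : Space d → ℝ) : Submodule ℂ (Fock d × Fock d) where
  carrier := {p | ∀ m, comp p.2 m =ᵐ[volume] fun K => ((ħ * ∑ j, w (K j) : ℝ) : ℂ) * comp p.1 m K}
  add_mem' := by
    rintro ⟨a, b⟩ ⟨a', b'⟩ h h' m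
    filter_upwards [h m, h' m, comp_add a a' m, comp_add b b' m] with K h1 h2 h3 h4
    simp only [Prod.mk_add_mk, h3, h4, Pi.add_apply] at h1 h2 ⊢
    rw [h1, h2]; ring
  zero_mem' := by
    intro m
    filter_upwards [comp_zero (d := d) m] with K h1
    simp [h1]
  smul_mem' := by
    rintro c ⟨a, b⟩ h m
    filter_upwards [h m, comp_smul c a m, comp_smul c b m] with K h1 h2 h3
    simp only [Prod.smul_mk, h2, h3, Pi.smul_apply, smul_eq_mul] at h1 ⊢
    rw [h1]; ring

/-- The `ħ`-scaled second quantization `dΓ(w)` of multiplication by `w`, on its maximal domain. -/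
def secondQuant {d : ℕ} (ħ : ℝ) (w : Space d → ℝ) : Fock d →ₗ.[ℂ] Fock d :=
  (secondQuantGraph ħ w).toLinearPMap

theorem graph_secondQuant {d : ℕ} (ħ : ℝ) (w : Space d → ℝ) :
    (secondQuant ħ w).graph = secondQuantGraph ħ w := by
  refine Submodule.toLinearPMap_graph_eq _ ?_
  rintro ⟨a, b⟩ h h0
  have h0' : a = 0 := h0
  subst h0'
  refine comp_ext fun m => ?_
  filter_upwards [h m, comp_zero (d := d) m] with K h1 h2
  rw [h1, h2]; simp

theorem comp_mul_snoc_add {d m : ℕ} (g : Space d → ℂ) (ψ φ : Fock d) :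
    ∀ᵐ K : Fin m → Space d,
      (fun k => conj (g k) * comp (ψ + φ) (m + 1) (Fin.snoc K k)) =ᵐ[volume]
      fun k => conj (g k) * comp ψ (m + 1) (Fin.snoc K k) +
        conj (g k) * comp φ (m + 1) (Fin.snoc K k) := by
  filter_upwards [ae_snoc (comp_add ψ φ (m + 1))] with K hK
  filter_upwards [hK] with k hk
  rw [hk, Pi.add_apply, mul_add]

theorem comp_mul_snoc_zero {d m : ℕ} (g : Space d → ℂ) :
    ∀ᵐ K : Fin m → Space d,
      (fun k => conj (g k) * comp (0 : Fock d) (m + 1) (Fin.snoc K k)) =ᵐ[volume]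
      fun _ => (0 : ℂ) := by
  filter_upwards [ae_snoc (comp_zero (d := d) (m + 1))] with K hK
  filter_upwards [hK] with k hk
  rw [hk, Pi.zero_apply, mul_zero]

theorem comp_mul_snoc_smul {d m : ℕ} (g : Space d → ℂ) (c : ℂ) (ψ : Fock d) :
    ∀ᵐ K : Fin m → Space d,
      (fun k => conj (g k) * comp (c • ψ) (m + 1) (Fin.snoc K k)) =ᵐ[volume]
      fun k => c * (conj (g k) * comp ψ (m + 1) (Fin.snoc K k)) := by
  filter_upwards [ae_snoc (comp_smul c ψ (m + 1))] with K hK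
  filter_upwards [hK] with k hk
  rw [hk, Pi.smul_apply, smul_eq_mul, mul_left_comm]

/-- The relation `a_ħ(g) ψ = φ`: for all `m`,
`φᵐ(k₁, …, kₘ) = √(ħ(m+1)) ∫ conj (g k) ψᵐ⁺¹(k₁, …, kₘ, k) dk`, where the integrals converge
absolutely (which is automatic when `g` is square integrable). -/
def IsAnnihilation {d : ℕ} (ħ : ℝ) (g : Space d → ℂ) (ψ φ : Fock d) : Prop :=
  ∀ m : ℕ,
    (∀ᵐ K : Fin m → Space d, Integrable fun k => conj (g k) * comp ψ (m + 1) (Fin.snoc K k)) ∧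
    comp φ m =ᵐ[volume] fun K =>
      (√(ħ * (m + 1)) : ℂ) * ∫ k, conj (g k) * comp ψ (m + 1) (Fin.snoc K k)

theorem IsAnnihilation.add {d : ℕ} {ħ : ℝ} {g : Space d → ℂ} {a b a' b' : Fock d}
    (h : IsAnnihilation ħ g a b) (h' : IsAnnihilation ħ g a' b') :
    IsAnnihilation ħ g (a + a') (b + b') := by
  intro m
  refine ⟨?_, ?_⟩
  · filter_upwards [comp_mul_snoc_add g a a', (h m).1, (h' m).1] with K hK h1 h2
    exact (integrable_congr hK).2 (h1.add h2)
  · filter_upwards [comp_mul_snoc_add g a a', (h m).1, (h' m).1, (h m).2, (h' m).2,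
      comp_add b b' m] with K hK h1 h2 h3 h4 h5
    rw [h5, integral_congr_ae hK, integral_add h1 h2, mul_add, Pi.add_apply, h3, h4]

theorem IsAnnihilation.zero {d : ℕ} (ħ : ℝ) (g : Space d → ℂ) :
    IsAnnihilation ħ g 0 0 := by
  intro m
  refine ⟨?_, ?_⟩
  · filter_upwards [comp_mul_snoc_zero g] with K hK
    exact (integrable_congr hK).2 (integrable_zero _ _ _)
  · filter_upwards [comp_mul_snoc_zero g, comp_zero (d := d) m] with K hK h1
    rw [h1, integral_congr_ae hK, integral_zero, mul_zero, Pi.zero_apply]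

theorem IsAnnihilation.smul {d : ℕ} {ħ : ℝ} {g : Space d → ℂ} {a b : Fock d} (c : ℂ)
    (h : IsAnnihilation ħ g a b) : IsAnnihilation ħ g (c • a) (c • b) := by
  intro m
  refine ⟨?_, ?_⟩
  · filter_upwards [comp_mul_snoc_smul g c a, (h m).1] with K hK h1
    exact (integrable_congr hK).2 (h1.const_mul c)
  · filter_upwards [comp_mul_snoc_smul g c a, (h m).2, comp_smul c b m] with K hK h3 h5
    rw [h5, integral_congr_ae hK, integral_const_mul, Pi.smul_apply, smul_eq_mul, h3,
      mul_left_comm]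

/-- Graph of the annihilation operator `a_ħ(g)`. -/
def annihilationGraph {d : ℕ} (ħ : ℝ) (g : Space d → ℂ) : Submodule ℂ (Fock d × Fock d) where
  carrier := {p | IsAnnihilation ħ g p.1 p.2}
  add_mem' h h' := IsAnnihilation.add h h'
  zero_mem' := IsAnnihilation.zero ħ g
  smul_mem' c _ h := IsAnnihilation.smul c h

/-- The `ħ`-scaled annihilation operator `a_ħ(g)` on its maximal domain. -/
def annihilation {d : ℕ} (ħ : ℝ) (g : Space d → ℂ) : Fock d →ₗ.[ℂ] Fock d :=
  (annihilationGraph ħ g).toLinearPMap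

theorem graph_annihilation {d : ℕ} (ħ : ℝ) (g : Space d → ℂ) :
    (annihilation ħ g).graph = annihilationGraph ħ g := by
  refine Submodule.toLinearPMap_graph_eq _ ?_
  rintro ⟨a, b⟩ h h0
  have h0' : a = 0 := h0
  subst h0'
  exact comp_ext fun m => ((h : IsAnnihilation ħ g 0 b) m).2.trans
    ((IsAnnihilation.zero ħ g) m).2.symm

/-- The `m`-particle component of `a*_ħ(g) ψ`: zero for `m = 0`, and otherwise
`√ħ / √m ∑ⱼ g(kⱼ) ψᵐ⁻¹(k₁, …, k̂ⱼ, …, kₘ)`. -/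
def creationComp {d : ℕ} (ħ : ℝ) (g : Space d → ℂ) (ψ : Fock d) :
    (m : ℕ) → (Fin m → Space d) → ℂ
  | 0 => fun _ => 0
  | m + 1 => fun K =>
      (√ħ / √(m + 1 : ℝ) : ℂ) * ∑ j : Fin (m + 1), g (K j) * comp ψ m (j.removeNth K)

/-- Graph of the creation operator `a*_ħ(g)`. -/
def creationGraph {d : ℕ} (ħ : ℝ) (g : Space d → ℂ) : Submodule ℂ (Fock d × Fock d) where
  carrier := {p | ∀ m, comp p.2 m =ᵐ[volume] creationComp ħ g p.1 m}
  add_mem' := by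
    rintro ⟨a, b⟩ ⟨a', b'⟩ h h' m
    cases m with
    | zero =>
      filter_upwards [h 0, h' 0, comp_add b b' 0] with K h1 h2 h3
      simp only [creationComp, Prod.mk_add_mk, h3, Pi.add_apply] at h1 h2 ⊢
      rw [h1, h2, add_zero]
    | succ m =>
      have hs := ae_all_iff.2 fun j : Fin (m + 1) => ae_removeNth j (comp_add a a' m)
      filter_upwards [h (m + 1), h' (m + 1), comp_add b b' (m + 1), hs] with K h1 h2 h3 h4
      simp only [creationComp, Prod.mk_add_mk, h3, Pi.add_apply] at h1 h2 h4 ⊢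
      simp only [h1, h2, h4, mul_add, Finset.sum_add_distrib]
  zero_mem' := by
    intro m
    cases m with
    | zero => exact comp_zero (d := d) 0
    | succ m =>
      have hs := ae_all_iff.2 fun j : Fin (m + 1) => ae_removeNth j (comp_zero (d := d) m)
      filter_upwards [comp_zero (d := d) (m + 1), hs] with K h1 h2
      simp [creationComp, h1, h2]
  smul_mem' := by
    rintro c ⟨a, b⟩ h m
    cases m with
    | zero =>
      filter_upwards [h 0, comp_smul c b 0] with K h1 h3
      simp only [creationComp, Prod.smul_mk, h3, Pi.smul_apply, smul_eq_mul] at h1 ⊢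
      rw [h1, mul_zero]
    | succ m =>
      have hs := ae_all_iff.2 fun j : Fin (m + 1) => ae_removeNth j (comp_smul c a m)
      filter_upwards [h (m + 1), comp_smul c b (m + 1), hs] with K h1 h3 h4
      simp only [creationComp, Prod.smul_mk, h3, Pi.smul_apply, smul_eq_mul] at h1 h4 ⊢
      simp only [h1, h4, Finset.mul_sum]
      exact Finset.sum_congr rfl fun j _ => by ring

/-- The `ħ`-scaled creation operator `a*_ħ(g)` on its maximal domain. -/
def creation {d : ℕ} (ħ : ℝ) (g : Space d → ℂ) : Fock d →ₗ.[ℂ] Fock d :=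
  (creationGraph ħ g).toLinearPMap

theorem graph_creation {d : ℕ} (ħ : ℝ) (g : Space d → ℂ) :
    (creation ħ g).graph = creationGraph ħ g := by
  refine Submodule.toLinearPMap_graph_eq _ ?_
  rintro ⟨a, b⟩ h h0
  have h0' : a = 0 := h0
  subst h0'
  refine comp_ext fun m => ?_
  filter_upwards [h m, (creationGraph ħ g).zero_mem m] with K h1 h2
  rw [h1]; exact h2.symm

/-! ### The Nelson Hamiltonian -/

/-- The configuration space `ℝ^{dn}` of `n` particles; `x j` is the position of the `j`-th one. -/
abbrev Config (d n : ℕ) := PiLp 2 fun _ : Fin n => Space d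

/-- The Hilbert space `L²(ℝ^{dn}) ⊗ Γ_s(L²(ℝᵈ))`, realized as `L²(ℝ^{dn}; Γ_s(L²(ℝᵈ)))`. -/
abbrev Hilb (d n : ℕ) := Lp (Fock d) 2 (volume : Measure (Config d n))

/-- The dispersion relation `ω(k) = √(k² + m_f²)`. -/
def dispersion {d : ℕ} (mf : ℝ) (k : Space d) : ℝ := √(‖k‖ ^ 2 + mf ^ 2)

/-- The two choices of the kinetic energy of a particle. -/
inductive Kinematics
  | semiRelativistic
  | nonRelativistic

/-- The kinetic energy `√(p² + M²)` or `p² / (2M)` of a particle of mass `M`. -/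
def kineticEnergy {d : ℕ} (c : Kinematics) (M : ℝ) (p : Space d) : ℝ :=
  match c with
  | .semiRelativistic => √(‖p‖ ^ 2 + M ^ 2)
  | .nonRelativistic => ‖p‖ ^ 2 / (2 * M)

/-- `f(p̂ⱼ)` for `p̂ⱼ = -iħ∇_{xⱼ}`: since the Fourier transform is `∫ e^{-2πi x·ξ} ψ(x) dx`, the
momentum `p̂ⱼ` becomes multiplication by `2πħ ξⱼ`. -/
def momentumOp {d n : ℕ} (ħ : ℝ) (f : Space d → ℝ) (j : Fin n) : Hilb d n →ₗ.[ℂ] Hilb d n :=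
  conjOp (Lp.fourierTransformₗᵢ (Config d n) (Fock d))
    (mulOp volume fun ξ : Config d n => f ((2 * Real.pi * ħ) • ξ j))

/-- `Ĥ₀₁ = ∑ⱼ fⱼ(p̂ⱼ)`, on the intersection of the domains. -/
def hamiltonian01 {d n : ℕ} (ħ : ℝ) (c : Fin n → Kinematics) (M : Fin n → ℝ) :
    Hilb d n →ₗ.[ℂ] Hilb d n :=
  ∑ j, momentumOp (d := d) (n := n) ħ (kineticEnergy (c j) (M j)) j

/-- `Ĥ₀₂ = dΓ(ω)`. -/
def hamiltonian02 {d n : ℕ} (ħ mf : ℝ) : Hilb d n →ₗ.[ℂ] Hilb d n :=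
  fibreOp volume fun _ => secondQuant ħ (dispersion mf)

/-- `Ĥ₀ = Ĥ₀₁ + Ĥ₀₂`, on the intersection of the domains. -/
def hamiltonian0 {d n : ℕ} (ħ mf : ℝ) (c : Fin n → Kinematics) (M : Fin n → ℝ) :
    Hilb d n →ₗ.[ℂ] Hilb d n :=
  hamiltonian01 (d := d) (n := n) ħ c M + hamiltonian02 (d := d) (n := n) ħ mf

/-- The coupling function `k ↦ ∑ⱼ χ(k) / √ω(k) e^{-2πi k·xⱼ}` at the configuration `x`. -/
def coupling {d n : ℕ} (mf : ℝ) (χ : Space d → ℝ) (x : Config d n) (k : Space d) : ℂ :=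
  ∑ j, ((χ k / √(dispersion mf k) : ℝ) : ℂ) *
    Complex.exp (-2 * Real.pi * Complex.I * (⟪k, x j⟫_ℝ : ℂ))

/-- `Ĥ₁ = a_ħ(G) + a*_ħ(G)`, on the intersection of the domains. -/
def hamiltonian1 {d n : ℕ} (ħ mf : ℝ) (χ : Space d → ℝ) : Hilb d n →ₗ.[ℂ] Hilb d n :=
  fibreOp volume (fun x => annihilation ħ (coupling mf χ x)) +
    fibreOp volume (fun x => creation ħ (coupling mf χ x))

/-- The Nelson Hamiltonian `Ĥ = Ĥ₀ + V(q̂) + Ĥ₁`, on the intersection of the domains. -/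
def hamiltonian {d n : ℕ} (ħ mf : ℝ) (c : Fin n → Kinematics) (M : Fin n → ℝ)
    (V : Config d n → ℝ) (χ : Space d → ℝ) : Hilb d n →ₗ.[ℂ] Hilb d n :=
  hamiltonian0 (d := d) (n := n) ħ mf c M + mulOp volume V + hamiltonian1 (d := d) (n := n) ħ mf χ

/-- `V ∈ C²_b`: `V` is twice continuously differentiable and bounded together with its derivatives
of order one and two. -/
def IsC2b {E : Type*} [NormedAddCommGroup E] [NormedSpace ℝ E] (V : E → ℝ) : Prop :=
  ContDiff ℝ 2 V ∧ ∀ i ≤ 2, ∃ C : ℝ, ∀ x, ‖iteratedFDeriv ℝ i V x‖ ≤ C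

end Nelson

end

/-!
# Self-adjointness of the Nelson Hamiltonian

The proof is a Kato–Rellich argument: `V + Ĥ₁` is symmetric and bounded relative to the free
Hamiltonian `Ĥ₀` with relative bound less than one.

For the abstract part, a symmetric operator `A` for which `A + iλ` and `A - iλ` are onto is densely
defined and self-adjoint (`IsSymm.isSelfAdjoint`). If `A + iλ` is onto for all real `λ ≠ 0` and
`H - A` is `A`-bounded with bound less than one, then for large `|λ|` the equation
`(H + iλ) ψ = φ` becomes a fixed point equation for a contraction
(`IsSymm.isSelfAdjoint_of_relatively_bounded`).

The Fourier transform in `X` turns `Ĥ₀₁` into multiplication by a nonnegative function `h(ξ)`. It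
commutes with bounded operators acting on the values of a function (`fourier_compLpL`), hence with
the resolvent of `dΓ(ω)` and with `Ĥ₀₂` itself. So `Ĥ₀` becomes the fibred operator
`h(ξ) + dΓ(ω)`. Its resolvents are multiplication operators in each sector of the Fock space and
depend continuously on `h(ξ)`, which makes `Ĥ₀ + iλ` onto (`hamiltonian0_surjective`); and
`‖Ĥ₀₂ ψ‖ ≤ ‖Ĥ₀ ψ‖` because both summands are nonnegative in each fibre
(`norm_hamiltonian02_le`).

For the interaction, the Cauchy–Schwarz inequality in one momentum variable bounds `a(g)` and
`a*(g)` between neighbouring sectors by `‖g‖ √(ħ(m+1))`. Since `ω ≥ m_f > 0`, the number of bosons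
is at most a multiple of the field energy, so both operators are infinitesimally bounded with
respect to `dΓ(ω)` (`isFieldOperator_annihilation`, `isFieldOperator_creation`), and they are
formally adjoint (`inner_creation_eq`). The function `X ↦ G_X` is continuous into `L²` by dominated
convergence, so that `X ↦ a(G_X) (dΓ(ω) + i)⁻¹` is norm continuous
(`IsFieldOperator.exists_continuous`); this gives the measurability needed for the fibred operators
to be defined on all of `D(Ĥ₀₂)`.
-/

namespace Nelson

/-! ### Self-adjointness criteria -/

section Abstract

variable {E : Type*} [NormedAddCommGroup E] [InnerProductSpace ℂ E]

/-- The partially defined operator `A` is symmetric, expressed through pairs in its graph. Density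
of the domain is not part of the definition. -/
def IsSymm (A : E →ₗ.[ℂ] E) : Prop :=
  ∀ p ∈ A.graph, ∀ q ∈ A.graph, ⟪p.2, q.1⟫_ℂ = ⟪p.1, q.2⟫_ℂ

theorem IsSymm.add {A B : E →ₗ.[ℂ] E} (hA : IsSymm A) (hB : IsSymm B) : IsSymm (A + B) := by
  rintro ⟨_, _⟩ hp ⟨_, _⟩ hq
  obtain ⟨x, rfl, rfl⟩ := (LinearPMap.mem_graph_iff _).1 hp
  obtain ⟨y, rfl, rfl⟩ := (LinearPMap.mem_graph_iff _).1 hq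
  rw [LinearPMap.add_apply, LinearPMap.add_apply, inner_add_left, inner_add_right]
  congr 1
  · exact hA _ (A.mem_graph ⟨x, x.2.1⟩) _ (A.mem_graph ⟨y, y.2.1⟩)
  · exact hB _ (B.mem_graph ⟨x, x.2.2⟩) _ (B.mem_graph ⟨y, y.2.2⟩)

theorem mem_graph_add {A B : E →ₗ.[ℂ] E} {p : E × E} :
    p ∈ (A + B).graph ↔
      ∃ a b, (p.1, a) ∈ A.graph ∧ (p.1, b) ∈ B.graph ∧ p.2 = a + b := by
  constructor
  · intro hp
    obtain ⟨x, h1, h2⟩ := (LinearPMap.mem_graph_iff _).1 hp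
    refine ⟨A ⟨x, x.2.1⟩, B ⟨x, x.2.2⟩, ?_, ?_, ?_⟩
    · rw [← h1]; exact A.mem_graph ⟨x, x.2.1⟩
    · rw [← h1]; exact B.mem_graph ⟨x, x.2.2⟩
    · rw [← h2]; rfl
  · rintro ⟨a, b, ha, hb, h⟩
    obtain ⟨x, h1, h2⟩ := (LinearPMap.mem_graph_iff _).1 ha
    obtain ⟨y, h3, h4⟩ := (LinearPMap.mem_graph_iff _).1 hb
    refine (LinearPMap.mem_graph_iff _).2 ⟨⟨p.1, ?_, ?_⟩, rfl, ?_⟩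
    · rw [← h1]; exact x.2
    · rw [← h3]; exact y.2
    · simp only at h1 h2 h3 h4
      rw [LinearPMap.add_apply, h, ← h2, ← h4]
      congr 2
      · exact Subtype.ext h1.symm
      · exact Subtype.ext h3.symm

/-- For symmetric `A` the cross terms of `‖(A + iλ) x‖²` cancel. -/
theorem IsSymm.norm_add_smul_sq {A : E →ₗ.[ℂ] E} (hA : IsSymm A) (l : ℝ) {p : E × E}
    (hp : p ∈ A.graph) :
    ‖p.2 + (l * Complex.I : ℂ) • p.1‖ ^ 2 = ‖p.2‖ ^ 2 + l ^ 2 * ‖p.1‖ ^ 2 := by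
  have h1 : (⟪p.2, p.1⟫_ℂ).im = 0 := by
    have h2 := hA p hp p hp
    have h3 := inner_conj_symm (𝕜 := ℂ) p.2 p.1
    rw [← h2] at h3
    exact Complex.conj_eq_iff_im.1 h3
  have h2 : RCLike.re ⟪p.2, (l * Complex.I : ℂ) • p.1⟫_ℂ = 0 := by
    rw [inner_smul_right]
    simp [h1]
  rw [norm_add_sq (𝕜 := ℂ), h2, norm_smul]
  simp [mul_pow]

theorem IsSymm.abs_mul_norm_le {A : E →ₗ.[ℂ] E} (hA : IsSymm A) (l : ℝ) {p : E × E}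
    (hp : p ∈ A.graph) : |l| * ‖p.1‖ ≤ ‖p.2 + (l * Complex.I : ℂ) • p.1‖ := by
  refine abs_le_of_sq_le_sq' ?_ (norm_nonneg _) |>.2
  rw [hA.norm_add_smul_sq l hp, mul_pow, sq_abs]
  linarith [sq_nonneg ‖p.2‖]

theorem IsSymm.norm_le {A : E →ₗ.[ℂ] E} (hA : IsSymm A) (l : ℝ) {p : E × E}
    (hp : p ∈ A.graph) : ‖p.2‖ ≤ ‖p.2 + (l * Complex.I : ℂ) • p.1‖ := by
  refine abs_le_of_sq_le_sq' ?_ (norm_nonneg _) |>.2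
  rw [hA.norm_add_smul_sq l hp]
  nlinarith [sq_nonneg (l * ‖p.1‖)]

variable [CompleteSpace E]

/-- The basic criterion: a symmetric operator for which `A + iλ` and `A - iλ` are onto, for some
real `λ ≠ 0`, is densely defined and self-adjoint. -/
theorem IsSymm.isSelfAdjoint {A : E →ₗ.[ℂ] E} (hA : IsSymm A) {l : ℝ} (hl : l ≠ 0)
    (h₁ : ∀ y, ∃ p ∈ A.graph, p.2 + (l * Complex.I : ℂ) • p.1 = y)
    (h₂ : ∀ y, ∃ p ∈ A.graph, p.2 + ((-l : ℝ) * Complex.I : ℂ) • p.1 = y) :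
    IsSelfAdjoint A := by
  -- a vector orthogonal to the domain is `(A + iλ) x`, so that `⟪(A + iλ) x, x⟫ = 0`; the imaginary
  -- part of this equation is a nonzero multiple of `‖x‖ ^ 2`
  have hdense : Dense (A.domain : Set E) := by
    rw [Submodule.dense_iff_topologicalClosure_eq_top,
      Submodule.topologicalClosure_eq_top_iff, Submodule.eq_bot_iff]
    intro y hy
    obtain ⟨p, hp, rfl⟩ := h₁ y
    have h0 := (Submodule.mem_orthogonal _ _).1 hy p.1 (LinearPMap.mem_domain_of_mem_graph hp)
    have h1 := hA p hp p hp
    have h2 := inner_conj_symm (𝕜 := ℂ) p.2 p.1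
    rw [← h1] at h2
    have h3 := Complex.conj_eq_iff_im.1 h2
    rw [inner_add_right, inner_smul_right, inner_self_eq_norm_sq_to_K, ← h1] at h0
    have h4 := congrArg Complex.im h0
    have h5 : p.1 = 0 := by
      have : ((‖p.1‖ : ℂ) ^ 2).im = 0 := by norm_cast
      have h6 : ((‖p.1‖ : ℂ) ^ 2).re = ‖p.1‖ ^ 2 := by norm_cast
      simp [h3, h6, hl] at h4
      exact h4
    have h6 : p.2 = 0 := A.graph_fst_eq_zero_snd hp h5
    simp [h5, h6]
  rw [LinearPMap.isSelfAdjoint_def]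
  have hle : A ≤ A.adjoint := by
    refine LinearPMap.IsFormalAdjoint.le_adjoint hdense ?_
    intro x y
    exact hA _ (A.mem_graph x) _ (A.mem_graph y)
  refine (LinearPMap.eq_of_le_of_domain_eq hle (le_antisymm hle.1 ?_)).symm
  intro y hy
  obtain ⟨p, hp, hpy⟩ := h₁ (A.adjoint ⟨y, hy⟩ + (l * Complex.I : ℂ) • y)
  -- `y - p.1` is orthogonal to the range of `A - iλ`
  have key : y - p.1 = 0 := by
    obtain ⟨q, hq, hqy⟩ := h₂ (y - p.1)
    obtain ⟨x, hx1, hx2⟩ := (LinearPMap.mem_graph_iff _).1 hq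
    have e1 : ⟪q.2, y⟫_ℂ = ⟪q.1, A.adjoint ⟨y, hy⟩⟫_ℂ := by
      have := LinearPMap.adjoint_isFormalAdjoint hdense ⟨y, hy⟩ x
      rw [hx1, hx2] at this
      rw [← inner_conj_symm, ← this, inner_conj_symm]
    have e2 : ⟪q.2, p.1⟫_ℂ = ⟪q.1, p.2⟫_ℂ := hA q hq p hp
    have e3 : ⟪q.2 + ((-l : ℝ) * Complex.I : ℂ) • q.1, y - p.1⟫_ℂ = 0 := by
      have e4 : A.adjoint ⟨y, hy⟩ = p.2 + (l * Complex.I : ℂ) • p.1 - (l * Complex.I : ℂ) • y := by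
        rw [hpy]; abel
      rw [inner_add_left, inner_sub_right, inner_smul_left, e1, e2, e4]
      simp only [inner_sub_right, inner_add_right, inner_smul_right, map_mul, Complex.conj_I,
        Complex.conj_ofReal]
      push_cast
      ring
    rw [hqy] at e3
    exact inner_self_eq_zero.1 e3
  rw [sub_eq_zero.1 key]
  exact LinearPMap.mem_domain_of_mem_graph hp

/-- The Kato–Rellich theorem. The range condition on `A + iλ` replaces self-adjointness of `A`. -/
theorem IsSymm.isSelfAdjoint_of_relatively_bounded {A H : E →ₗ.[ℂ] E} (hA : IsSymm A)
    (hsurj : ∀ l : ℝ, l ≠ 0 → ∀ y, ∃ p ∈ A.graph, p.2 + (l * Complex.I : ℂ) • p.1 = y)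
    (hH : IsSymm H) {a b : ℝ} (ha0 : 0 ≤ a) (ha : a < 1) (hb : 0 ≤ b)
    (hdom : A.domain ≤ H.domain)
    (hbound : ∀ x y z, (x, y) ∈ A.graph → (x, z) ∈ H.graph → ‖z - y‖ ≤ a * ‖y‖ + b * ‖x‖) :
    IsSelfAdjoint H := by
  -- for this `l` the norm of `(H - A) (A ± i l)⁻¹` is at most `(a + 1) / 2`
  obtain ⟨l, hl, hab⟩ : ∃ l : ℝ, 0 < l ∧ a + b / l < 1 := by
    refine ⟨2 * (b + 1) / (1 - a), by have : 0 < 1 - a := by linarith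
                                      positivity, ?_⟩
    have h1 : 0 < 1 - a := by linarith
    have h2 : b / (2 * (b + 1) / (1 - a)) = (1 - a) * (b / (2 * (b + 1))) := by field_simp
    have h3 : b / (2 * (b + 1)) < 1 := by rw [div_lt_one (by positivity)]; linarith
    rw [h2]; nlinarith
  have main : ∀ s : ℝ, |s| = l → ∀ φ, ∃ p ∈ H.graph, p.2 + (s * Complex.I : ℂ) • p.1 = φ := by
    intro s hs φ
    have hs0 : s ≠ 0 := by rintro rfl; simp at hs; linarith
    choose R hR hR' using hsurj s hs0
    have hdomR : ∀ u, (R u).1 ∈ H.domain := fun u =>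
      hdom (LinearPMap.mem_domain_of_mem_graph (hR u))
    have hest : ∀ u v, ‖(H ⟨_, hdomR u⟩ - (R u).2) - (H ⟨_, hdomR v⟩ - (R v).2)‖ ≤
        (a + b / l) * ‖u - v‖ := by
      intro u v
      have h1 := A.graph.sub_mem (hR u) (hR v)
      have h2 := H.graph.sub_mem (H.mem_graph ⟨_, hdomR u⟩) (H.mem_graph ⟨_, hdomR v⟩)
      have h3 := hbound _ _ _ h1 h2
      have h4 := hA.norm_le s h1
      have h5 := hA.abs_mul_norm_le s h1
      have h6 : (R u - R v).2 + (s * Complex.I : ℂ) • (R u - R v).1 = u - v := by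
        calc _ = ((R u).2 + (s * Complex.I : ℂ) • (R u).1) -
              ((R v).2 + (s * Complex.I : ℂ) • (R v).1) := by
              rw [Prod.fst_sub, Prod.snd_sub, smul_sub]; abel
          _ = u - v := by rw [hR', hR']
      rw [h6] at h4 h5
      rw [hs] at h5
      have h7 : ‖(R u - R v).1‖ ≤ ‖u - v‖ / l := by
        rw [le_div_iff₀ hl]; linarith
      calc _ = ‖(H ⟨_, hdomR u⟩ - H ⟨_, hdomR v⟩) - ((R u).2 - (R v).2)‖ := by congr 1; abel
        _ ≤ a * ‖(R u - R v).2‖ + b * ‖(R u - R v).1‖ := h3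
        _ ≤ a * ‖u - v‖ + b * (‖u - v‖ / l) := by gcongr
        _ = _ := by ring
    have hc : ContractingWith (Real.toNNReal (a + b / l))
        (fun u => φ - (H ⟨_, hdomR u⟩ - (R u).2)) := by
      refine ⟨by simpa using hab, LipschitzWith.of_dist_le_mul fun u v => ?_⟩
      rw [dist_eq_norm, dist_eq_norm, Real.coe_toNNReal _ (by positivity), sub_sub_sub_cancel_left,
        norm_sub_rev u v]
      exact hest v u
    -- a fixed point `u` solves `u + (H - A) (A + i s)⁻¹ u = φ`
    obtain ⟨u, hu, -⟩ := hc.exists_fixedPoint 0 (edist_ne_top _ _)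
    refine ⟨_, H.mem_graph ⟨_, hdomR u⟩, ?_⟩
    have h1 : φ - (H ⟨_, hdomR u⟩ - (R u).2) = u := hu
    have h2 := hR' u
    calc _ = ((R u).2 + (s * Complex.I : ℂ) • (R u).1) + (H ⟨_, hdomR u⟩ - (R u).2) := by
          simp only; abel
      _ = u + (H ⟨_, hdomR u⟩ - (R u).2) := by rw [h2]
      _ = φ := (sub_eq_iff_eq_add.1 h1).symm
  exact hH.isSelfAdjoint hl.ne' (main l (abs_of_pos hl)) (main (-l) (by rw [abs_neg, abs_of_pos hl]))

end Abstract

/-! ### Fock vectors and their components -/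

section Fock

variable {d : ℕ}

/-- The `L²` norm of a function as a real number; it is meaningful for functions in `L²`. -/
noncomputable def l2norm {X F : Type*} [MeasurableSpace X] [NormedAddCommGroup F] (u : X → F)
    (μ : Measure X := by volume_tac) : ℝ := (eLpNorm u 2 μ).toReal

theorem l2norm_nonneg {X F : Type*} [MeasurableSpace X] [NormedAddCommGroup F] (u : X → F)
    (μ : Measure X) : 0 ≤ l2norm u μ := ENNReal.toReal_nonneg

theorem l2norm_congr {X F : Type*} [MeasurableSpace X] [NormedAddCommGroup F] {u v : X → F}
    {μ : Measure X} (h : u =ᵐ[μ] v) : l2norm u μ = l2norm v μ := by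
  rw [l2norm, l2norm, eLpNorm_congr_ae h]

theorem l2norm_le_mul {X F F' : Type*} [MeasurableSpace X] [NormedAddCommGroup F]
    [NormedAddCommGroup F'] {u : X → F} {v : X → F'} {μ : Measure X} {c : ℝ}
    (hc : 0 ≤ c) (hv : MemLp v 2 μ) (h : ∀ᵐ x ∂μ, ‖u x‖ ≤ c * ‖v x‖) :
    l2norm u μ ≤ c * l2norm v μ := by
  have h1 := eLpNorm_le_mul_eLpNorm_of_ae_le_mul h 2
  have h2 := ENNReal.toReal_mono (ENNReal.mul_ne_top ENNReal.ofReal_ne_top hv.2.ne) h1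
  rwa [ENNReal.toReal_mul, ENNReal.toReal_ofReal hc] at h2

theorem memLp_comp (ψ : Fock d) (m : ℕ) : MemLp (comp ψ m) 2 := Lp.memLp _

theorem mem_symL2_iff {m : ℕ} {u : Lp ℂ 2 (volume : Measure (Fin m → Space d))} :
    u ∈ symL2 d m ↔ ∀ σ : Equiv.Perm (Fin m), (fun K => u (K ∘ σ)) =ᵐ[volume] u := by
  rw [symL2, Submodule.mem_iInf]
  refine forall_congr' fun σ => ?_
  rw [LinearMap.mem_eqLocus]
  have h1 := Lp.coeFn_compMeasurePreserving u (measurePreserving_perm d m σ)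
  constructor
  · intro h
    have h2 : Lp.compMeasurePreserving (fun K : Fin m → Space d => K ∘ σ)
      (measurePreserving_perm d m σ) u = u := h
    rw [h2] at h1
    exact h1.symm
  · intro h
    exact Lp.ext (h1.trans h)

theorem comp_perm (ψ : Fock d) {m : ℕ} (σ : Equiv.Perm (Fin m)) :
    (fun K => comp ψ m (K ∘ σ)) =ᵐ[volume] comp ψ m :=
  mem_symL2_iff.1 (Fock.components d ψ m : symL2 d m).2 σ

theorem l2norm_comp (ψ : Fock d) (m : ℕ) : l2norm (comp ψ m) = ‖Fock.components d ψ m‖ := by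
  rw [Submodule.coe_norm, Lp.norm_def]; rfl

theorem hasSum_norm_sq (ψ : Fock d) :
    HasSum (fun m => l2norm (comp ψ m) ^ 2) (‖ψ‖ ^ 2) := by
  have h := lp.hasSum_norm (p := 2) (by simp) (Fock.components d ψ)
  rw [(Fock.components d).norm_map] at h
  simp only [← l2norm_comp] at h
  simpa using h

theorem hasSum_inner (ψ φ : Fock d) :
    HasSum (fun m => ∫ K, conj (comp ψ m K) * comp φ m K) ⟪ψ, φ⟫_ℂ := by
  have h := lp.hasSum_inner (𝕜 := ℂ) (Fock.components d ψ) (Fock.components d φ)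
  rw [(Fock.components d).inner_map_map] at h
  refine (funext fun m => ?_ : (fun m => ∫ K, conj (comp ψ m K) * comp φ m K) = _) ▸ h
  rw [Submodule.coe_inner, L2.inner_def]
  refine integral_congr_ae (Filter.Eventually.of_forall fun K => ?_)
  simp [comp, mul_comm]

/-- A sequence of symmetric square integrable functions with square summable norms is a Fock
vector. -/
theorem exists_fock (u : ∀ m, (Fin m → Space d) → ℂ) (hu : ∀ m, MemLp (u m) 2)
    (hs : ∀ m (σ : Equiv.Perm (Fin m)), (fun K => u m (K ∘ σ)) =ᵐ[volume] u m)
    (hsum : Summable fun m => l2norm (u m) ^ 2) :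
    ∃ η : Fock d, ∀ m, comp η m =ᵐ[volume] u m := by
  have hmem : ∀ m, (hu m).toLp (u m) ∈ symL2 d m := fun m => mem_symL2_iff.2 fun σ => by
    have h1 := (hu m).coeFn_toLp
    have h2 := (measurePreserving_perm d m σ).quasiMeasurePreserving.ae h1
    filter_upwards [h1, h2, hs m σ] with K h1 h2 h3
    rw [h1, h2, h3]
  have hℓ : Memℓp (fun m => (⟨_, hmem m⟩ : symL2 d m)) 2 := by
    refine memℓp_gen ?_
    refine hsum.congr fun m => ?_
    rw [Submodule.coe_norm, Lp.norm_toLp]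
    simp [l2norm]
  refine ⟨(Fock.components d).symm ⟨_, hℓ⟩, fun m => ?_⟩
  rw [comp, LinearIsometryEquiv.apply_symm_apply]
  exact (hu m).coeFn_toLp

theorem norm_sq_le_of_hasSum {ψ : Fock d} {b : ℕ → ℝ} {B : ℝ} (hb : HasSum b B)
    (h : ∀ m, l2norm (comp ψ m) ^ 2 ≤ b m) : ‖ψ‖ ^ 2 ≤ B :=
  hasSum_le h (hasSum_norm_sq ψ) hb

/-- Bounded symmetric multipliers act boundedly on the Fock space. -/
theorem exists_fockMultiplier (b : ∀ m, (Fin m → Space d) → ℂ) (hb : ∀ m, Measurable (b m))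
    (hs : ∀ m (σ : Equiv.Perm (Fin m)) K, b m (K ∘ σ) = b m K) {C : ℝ} (hC : 0 ≤ C)
    (hbd : ∀ m K, ‖b m K‖ ≤ C) :
    ∃ L : Fock d →L[ℂ] Fock d, ‖L‖ ≤ C ∧
      ∀ ψ m, comp (L ψ) m =ᵐ[volume] fun K => b m K * comp ψ m K := by
  have hle : ∀ (ψ : Fock d) m, ∀ᵐ K, ‖b m K * comp ψ m K‖ ≤ C * ‖comp ψ m K‖ := fun ψ m =>
    Filter.Eventually.of_forall fun K => by
      rw [norm_mul]; exact mul_le_mul_of_nonneg_right (hbd m K) (norm_nonneg _)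
  have hmem : ∀ (ψ : Fock d) m, MemLp (fun K => b m K * comp ψ m K) 2 := fun ψ m =>
    (memLp_comp ψ m).of_le_mul ((hb m).aestronglyMeasurable.mul (memLp_comp ψ m).1) (hle ψ m)
  have hn : ∀ (ψ : Fock d) m,
      l2norm (fun K => b m K * comp ψ m K) ^ 2 ≤ C ^ 2 * l2norm (comp ψ m) ^ 2 := fun ψ m => by
    rw [← mul_pow]
    exact pow_le_pow_left₀ (l2norm_nonneg _ _) (l2norm_le_mul hC (memLp_comp ψ m) (hle ψ m)) 2
  have hex : ∀ ψ : Fock d, ∃ η : Fock d, ∀ m, comp η m =ᵐ[volume] fun K => b m K * comp ψ m K := by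
    intro ψ
    refine exists_fock _ (hmem ψ) (fun m σ => ?_) ?_
    · filter_upwards [comp_perm ψ σ] with K hK
      rw [hK, hs]
    · exact Summable.of_nonneg_of_le (fun m => sq_nonneg _) (hn ψ)
        ((hasSum_norm_sq ψ).summable.mul_left _)
  choose L hL using hex
  refine ⟨LinearMap.mkContinuous ⟨⟨L, fun ψ φ => ?_⟩, fun c ψ => ?_⟩ C fun ψ => ?_,
    LinearMap.mkContinuous_norm_le _ hC _, hL⟩
  · refine comp_ext fun m => ?_
    filter_upwards [hL (ψ + φ) m, hL ψ m, hL φ m, comp_add ψ φ m, comp_add (L ψ) (L φ) m]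
      with K h1 h2 h3 h4 h5
    simp only [h1, h5, Pi.add_apply, h2, h3, h4, mul_add]
  · refine comp_ext fun m => ?_
    filter_upwards [hL (c • ψ) m, hL ψ m, comp_smul c ψ m, comp_smul c (L ψ) m]
      with K h1 h2 h4 h5
    simp only [h1, RingHom.id_apply, h5, Pi.smul_apply, h2, h4, smul_eq_mul, mul_left_comm]
  · refine abs_le_of_sq_le_sq' ?_ (by positivity) |>.2
    rw [mul_pow]
    refine norm_sq_le_of_hasSum ((hasSum_norm_sq ψ).mul_left (C ^ 2)) fun m => ?_
    refine le_of_eq_of_le ?_ (hn ψ m)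
    rw [← l2norm_congr (hL ψ m)]
    rfl

end Fock

/-! ### The free field energy -/

section FreeField

variable {d : ℕ} {ħ mf : ℝ}

theorem continuous_dispersion (mf : ℝ) : Continuous (dispersion (d := d) mf) := by
  unfold dispersion; fun_prop

theorem le_dispersion (k : Space d) : mf ≤ dispersion mf k :=
  Real.le_sqrt_of_sq_le (by linarith [sq_nonneg ‖k‖])

theorem dispersion_nonneg (k : Space d) : 0 ≤ dispersion mf k := Real.sqrt_nonneg _

/-- The field energy `ħ ∑ⱼ ω(kⱼ)`. -/
noncomputable def fieldEnergy (ħ mf : ℝ) {m : ℕ} (K : Fin m → Space d) : ℝ :=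
  ħ * ∑ j, dispersion mf (K j)

theorem measurable_fieldEnergy (m : ℕ) : Measurable (fieldEnergy (d := d) ħ mf (m := m)) := by
  unfold fieldEnergy
  refine (Finset.measurable_sum _ fun j _ => ?_).const_mul ħ
  exact (continuous_dispersion mf).measurable.comp (measurable_pi_apply j)

theorem fieldEnergy_nonneg (hħ : 0 < ħ) {m : ℕ} (K : Fin m → Space d) :
    0 ≤ fieldEnergy ħ mf K :=
  mul_nonneg hħ.le (Finset.sum_nonneg fun _ _ => dispersion_nonneg _)

theorem le_fieldEnergy (hħ : 0 < ħ) {m : ℕ} (K : Fin m → Space d) :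
    ħ * mf * m ≤ fieldEnergy ħ mf K := by
  have h := Finset.card_nsmul_le_sum Finset.univ (fun j => dispersion mf (K j)) mf
    fun j _ => le_dispersion _
  simp at h
  rw [fieldEnergy, mul_assoc, mul_comm mf]
  exact mul_le_mul_of_nonneg_left h hħ.le

theorem fieldEnergy_perm {m : ℕ} (σ : Equiv.Perm (Fin m)) (K : Fin m → Space d) :
    fieldEnergy ħ mf (K ∘ σ) = fieldEnergy ħ mf K := by
  unfold fieldEnergy
  congr 1
  exact Equiv.sum_comp σ fun j => dispersion mf (K j)

theorem mem_graph_secondQuant {p : Fock d × Fock d} :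
    p ∈ (secondQuant ħ (dispersion mf)).graph ↔
      ∀ m, comp p.2 m =ᵐ[volume] fun K => (fieldEnergy ħ mf K : ℂ) * comp p.1 m K := by
  rw [graph_secondQuant]; rfl

theorem isSymm_secondQuant : IsSymm (secondQuant (d := d) ħ (dispersion mf)) := by
  intro p hp q hq
  rw [mem_graph_secondQuant] at hp hq
  refine (hasSum_inner p.2 q.1).unique ?_
  convert hasSum_inner p.1 q.2 using 2 with m
  refine integral_congr_ae ?_
  filter_upwards [hp m, hq m] with K h1 h2
  rw [h1, h2, map_mul, Complex.conj_ofReal]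
  ring

theorem re_inner_secondQuant_nonneg (hħ : 0 < ħ) {p : Fock d × Fock d}
    (hp : p ∈ (secondQuant ħ (dispersion mf)).graph) : 0 ≤ (⟪p.1, p.2⟫_ℂ).re := by
  rw [mem_graph_secondQuant] at hp
  refine (Complex.hasSum_re (hasSum_inner p.1 p.2)).nonneg fun m => ?_
  have h1 : ∫ K, conj (comp p.1 m K) * comp p.2 m K =
      ((∫ K, fieldEnergy ħ mf K * ‖comp p.1 m K‖ ^ 2 : ℝ) : ℂ) := by
    rw [← integral_complex_ofReal]
    refine integral_congr_ae ?_
    filter_upwards [hp m] with K h1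
    rw [h1, mul_left_comm, Complex.conj_mul']
    push_cast
    rfl
  rw [h1, Complex.ofReal_re]
  exact integral_nonneg fun K => mul_nonneg (fieldEnergy_nonneg hħ K) (sq_nonneg _)

/-- Adding a nonnegative constant to the field energy does not decrease the norm. -/
theorem norm_le_norm_add_smul (hħ : 0 < ħ) {p : Fock d × Fock d}
    (hp : p ∈ (secondQuant ħ (dispersion mf)).graph) {t : ℝ} (ht : 0 ≤ t) :
    ‖p.2‖ ≤ ‖(t : ℂ) • p.1 + p.2‖ ∧ t * ‖p.1‖ ≤ ‖(t : ℂ) • p.1 + p.2‖ := by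
  have h1 := norm_add_sq (𝕜 := ℂ) ((t : ℂ) • p.1) p.2
  have h2 : RCLike.re ⟪(t : ℂ) • p.1, p.2⟫_ℂ = t * (⟪p.1, p.2⟫_ℂ).re := by
    rw [inner_smul_left]; simp
  have h3 : ‖(t : ℂ) • p.1‖ = t * ‖p.1‖ := by rw [norm_smul]; simp [abs_of_nonneg ht]
  have h4 := mul_nonneg ht (re_inner_secondQuant_nonneg hħ hp)
  rw [h2, h3] at h1
  constructor
  · refine abs_le_of_sq_le_sq' ?_ (norm_nonneg _) |>.2
    nlinarith [sq_nonneg (t * ‖p.1‖)]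
  · refine abs_le_of_sq_le_sq' ?_ (norm_nonneg _) |>.2
    nlinarith [sq_nonneg ‖p.2‖]

/-- The symbol `(s + |t| + iλ)⁻¹` of the resolvent; the absolute value makes it regular for all
real `t`. -/
noncomputable def resolventSymbol (l t s : ℝ) : ℂ := ((s + |t| : ℝ) + l * Complex.I : ℂ)⁻¹

theorem abs_le_norm_symbol (l t : ℝ) : |l| ≤ ‖((t : ℝ) + l * Complex.I : ℂ)‖ := by
  have := Complex.abs_im_le_norm ((t : ℝ) + l * Complex.I : ℂ)
  simpa using this

theorem symbol_ne_zero {l : ℝ} (hl : l ≠ 0) (t : ℝ) : ((t : ℝ) + l * Complex.I : ℂ) ≠ 0 := by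
  rw [← norm_pos_iff]
  exact (abs_pos.2 hl).trans_le (abs_le_norm_symbol l t)

theorem norm_resolventSymbol_le {l : ℝ} (hl : l ≠ 0) (t s : ℝ) :
    ‖resolventSymbol l t s‖ ≤ |l|⁻¹ := by
  rw [resolventSymbol, norm_inv]
  exact inv_anti₀ (abs_pos.2 hl) (abs_le_norm_symbol l _)

theorem norm_resolventSymbol_sub_le {l : ℝ} (hl : l ≠ 0) (t t' s : ℝ) :
    ‖resolventSymbol l t s - resolventSymbol l t' s‖ ≤ |l|⁻¹ * |l|⁻¹ * |t - t'| := by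
  have h1 : resolventSymbol l t s - resolventSymbol l t' s =
      resolventSymbol l t s * resolventSymbol l t' s * ((|t'| - |t| : ℝ) : ℂ) := by
    have := symbol_ne_zero hl (s + |t|)
    have := symbol_ne_zero hl (s + |t'|)
    unfold resolventSymbol
    field_simp
    push_cast
    ring
  rw [h1, norm_mul, norm_mul, Complex.norm_real, Real.norm_eq_abs]
  have h2 : |(|t'| - |t|)| ≤ |t - t'| := by
    rw [abs_sub_comm t]; exact abs_abs_sub_abs_le_abs_sub t' t
  gcongr
  · exact norm_resolventSymbol_le hl t s
  · exact norm_resolventSymbol_le hl t' s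

theorem exists_resolvent (d : ℕ) (ħ mf : ℝ) {l : ℝ} (hl : l ≠ 0) (t : ℝ) :
    ∃ L : Fock d →L[ℂ] Fock d, ‖L‖ ≤ |l|⁻¹ ∧
      ∀ ψ m, comp (L ψ) m =ᵐ[volume]
        fun K => resolventSymbol l t (fieldEnergy ħ mf K) * comp ψ m K := by
  refine exists_fockMultiplier (fun m K => resolventSymbol l t (fieldEnergy ħ mf K)) (fun m => ?_)
    (fun m σ K => by simp only [fieldEnergy_perm]) (by positivity)
    fun m K => norm_resolventSymbol_le hl _ _
  have := measurable_fieldEnergy (d := d) (ħ := ħ) (mf := mf) m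
  unfold resolventSymbol
  fun_prop

/-- The resolvent `(dΓ(ω) + |t| + iλ)⁻¹` of the field energy, for `λ ≠ 0`. -/
noncomputable def resolvent (d : ℕ) (ħ mf : ℝ) {l : ℝ} (hl : l ≠ 0) (t : ℝ) :
    Fock d →L[ℂ] Fock d :=
  (exists_resolvent d ħ mf hl t).choose

theorem norm_resolvent_le {l : ℝ} (hl : l ≠ 0) (t : ℝ) : ‖resolvent d ħ mf hl t‖ ≤ |l|⁻¹ :=
  (exists_resolvent d ħ mf hl t).choose_spec.1

theorem comp_resolvent {l : ℝ} (hl : l ≠ 0) (t : ℝ) (ψ : Fock d) (m : ℕ) :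
    comp (resolvent d ħ mf hl t ψ) m =ᵐ[volume]
      fun K => resolventSymbol l t (fieldEnergy ħ mf K) * comp ψ m K :=
  (exists_resolvent d ħ mf hl t).choose_spec.2 ψ m

theorem comp_sub (ψ φ : Fock d) (m : ℕ) : comp (ψ - φ) m =ᵐ[volume] comp ψ m - comp φ m := by
  rw [comp, map_sub]
  exact Lp.coeFn_sub _ _

theorem resolvent_mem_graph {l : ℝ} (hl : l ≠ 0) (t : ℝ) (φ : Fock d) :
    (resolvent d ħ mf hl t φ,
        φ - ((|t| : ℝ) + l * Complex.I : ℂ) • resolvent d ħ mf hl t φ) ∈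
      (secondQuant ħ (dispersion mf)).graph := by
  rw [mem_graph_secondQuant]
  intro m
  filter_upwards [comp_sub φ (((|t| : ℝ) + l * Complex.I : ℂ) • resolvent d ħ mf hl t φ) m,
    comp_smul ((|t| : ℝ) + l * Complex.I : ℂ) (resolvent d ħ mf hl t φ) m,
    comp_resolvent (ħ := ħ) (mf := mf) hl t φ m] with K h1 h2 h3
  rw [h1, Pi.sub_apply, h2, Pi.smul_apply, h3, smul_eq_mul]
  have h4 := symbol_ne_zero hl (fieldEnergy ħ mf K + |t|)
  rw [resolventSymbol]
  push_cast at h4 ⊢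
  field_simp
  ring

theorem continuous_resolvent {l : ℝ} (hl : l ≠ 0) : Continuous (resolvent d ħ mf hl) := by
  have h0 : (0 : ℝ) ≤ |l|⁻¹ * |l|⁻¹ := by positivity
  refine (LipschitzWith.of_dist_le_mul (K := Real.toNNReal (|l|⁻¹ * |l|⁻¹)) fun t t' => ?_).continuous
  rw [dist_eq_norm, dist_eq_norm, Real.norm_eq_abs, Real.coe_toNNReal _ h0]
  refine ContinuousLinearMap.opNorm_le_bound _ (by positivity) fun ψ => ?_
  refine abs_le_of_sq_le_sq' ?_ (by positivity) |>.2
  rw [mul_pow]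
  refine norm_sq_le_of_hasSum ((hasSum_norm_sq ψ).mul_left _) fun m => ?_
  rw [← mul_pow]
  refine pow_le_pow_left₀ (l2norm_nonneg _ _) (l2norm_le_mul (by positivity) (memLp_comp ψ m) ?_) 2
  filter_upwards [comp_sub (resolvent d ħ mf hl t ψ) (resolvent d ħ mf hl t' ψ) m,
    comp_resolvent (ħ := ħ) (mf := mf) hl t ψ m, comp_resolvent (ħ := ħ) (mf := mf) hl t' ψ m]
    with K h1 h2 h3
  rw [sub_apply, h1, Pi.sub_apply, h2, h3, ← sub_mul, norm_mul]
  exact mul_le_mul_of_nonneg_right (norm_resolventSymbol_sub_le hl t t' _) (norm_nonneg _)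

/-- The graph of the field energy in terms of the bounded operator `(dΓ(ω) + i)⁻¹`. -/
theorem mem_graph_iff_eq_resolvent {p : Fock d × Fock d} :
    p ∈ (secondQuant ħ (dispersion mf)).graph ↔
      p.1 = resolvent d ħ mf one_ne_zero 0 (p.2 + Complex.I • p.1) := by
  constructor
  · intro hp
    rw [mem_graph_secondQuant] at hp
    refine comp_ext fun m => ?_
    filter_upwards [hp m, comp_add p.2 (Complex.I • p.1) m, comp_smul Complex.I p.1 m,
      comp_resolvent (ħ := ħ) (mf := mf) one_ne_zero 0 (p.2 + Complex.I • p.1) m]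
      with K h1 h2 h3 h4
    rw [h4, h2, Pi.add_apply, h3, h1, Pi.smul_apply, smul_eq_mul, resolventSymbol]
    have h5 := symbol_ne_zero one_ne_zero (fieldEnergy ħ mf K)
    rw [← add_mul, abs_zero, add_zero, ← mul_assoc]
    rw [Complex.ofReal_one, one_mul] at h5 ⊢
    rw [inv_mul_cancel₀ h5, one_mul]
  · intro hp
    have h := resolvent_mem_graph (ħ := ħ) (mf := mf) one_ne_zero 0 (p.2 + Complex.I • p.1)
    rw [← hp] at h
    simpa using h

end FreeField

/-! ### Square integrable functions on products -/

section Product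

variable {α β : Type*} [MeasurableSpace α] [MeasurableSpace β] {μ : Measure α} {ν : Measure β}

theorem eLpNorm_two_sq {F : Type*} [NormedAddCommGroup F] (f : α → F) :
    eLpNorm f 2 μ ^ 2 = ∫⁻ x, ‖f x‖ₑ ^ 2 ∂μ := by
  have h := eLpNorm_nnreal_pow_eq_lintegral (μ := μ) (f := f) (p := 2) two_ne_zero
  simpa using h

theorem l2norm_sq_eq_integral {F : Type*} [NormedAddCommGroup F] {f : α → F} (hf : MemLp f 2 μ) :
    l2norm f μ ^ 2 = ∫ x, ‖f x‖ ^ 2 ∂μ := by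
  rw [l2norm, ← ENNReal.toReal_pow, eLpNorm_two_sq,
    integral_eq_lintegral_of_nonneg_ae (Filter.Eventually.of_forall fun x => sq_nonneg _)
      (hf.1.norm.pow 2)]
  simp only [ENNReal.ofReal_pow (norm_nonneg _), ofReal_norm]

theorem l2norm_add_le {F : Type*} [NormedAddCommGroup F] {f g : α → F} (hf : MemLp f 2 μ)
    (hg : MemLp g 2 μ) : l2norm (fun x => f x + g x) μ ≤ l2norm f μ + l2norm g μ := by
  rw [l2norm, l2norm, l2norm, ← ENNReal.toReal_add hf.2.ne hg.2.ne]
  exact ENNReal.toReal_mono (ENNReal.add_ne_top.2 ⟨hf.2.ne, hg.2.ne⟩)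
    (eLpNorm_add_le hf.1 hg.1 (by norm_num))

theorem l2norm_sum_le {F ι : Type*} [NormedAddCommGroup F] (s : Finset ι) {f : ι → α → F}
    (hf : ∀ i, MemLp (f i) 2 μ) : l2norm (fun x => ∑ i ∈ s, f i x) μ ≤ ∑ i ∈ s, l2norm (f i) μ := by
  classical
  induction s using Finset.induction_on with
  | empty => simp [l2norm]
  | insert a s ha ih =>
    simp only [Finset.sum_insert ha]
    refine (l2norm_add_le (hf a) (memLp_finsetSum s fun i _ => hf i)).trans ?_
    linarith

theorem l2norm_const_mul (c : ℂ) (f : α → ℂ) : l2norm (fun x => c * f x) μ = ‖c‖ * l2norm f μ := by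
  have h := eLpNorm_const_smul c f 2 μ
  rw [l2norm, l2norm, ← toReal_enorm c, ← ENNReal.toReal_mul, ← h]
  rfl

theorem l2norm_comp_measurePreserving {f : β → ℂ} (hf : MemLp f 2 ν) {e : α → β}
    (he : MeasurePreserving e μ ν) : l2norm (fun x => f (e x)) μ = l2norm f ν := by
  rw [l2norm, l2norm, ← eLpNorm_comp_measurePreserving hf.1 he]
  rfl

theorem enorm_integral_mul_sq_le {g u : β → ℂ} (hg : MemLp g 2 ν)
    (hu : AEStronglyMeasurable u ν) :
    ‖∫ y, conj (g y) * u y ∂ν‖ₑ ^ 2 ≤ eLpNorm g 2 ν ^ 2 * ∫⁻ y, ‖u y‖ₑ ^ 2 ∂ν := by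
  have h1 : AEStronglyMeasurable (fun y => conj (g y)) ν :=
    Complex.continuous_conj.comp_aestronglyMeasurable hg.1
  have h2 : eLpNorm (fun y => conj (g y)) 2 ν = eLpNorm g 2 ν :=
    eLpNorm_congr_norm_ae (Filter.Eventually.of_forall fun y => by simp)
  have h3 := eLpNorm_smul_le_mul_eLpNorm (p := 2) (q := 2) (r := 1) hu h1
  rw [← eLpNorm_two_sq, ← mul_pow, ← h2]
  refine pow_le_pow_left₀ zero_le (le_trans ?_ h3) 2
  rw [eLpNorm_one_eq_lintegral_enorm]
  exact enorm_integral_le_lintegral_enorm _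

variable [SFinite ν]

/-- Pairing with a square integrable function in one variable is bounded on `L²`, by the
Cauchy–Schwarz inequality in that variable. -/
theorem memLp_integral_mul [SFinite μ] {g : β → ℂ} (hg : MemLp g 2 ν) {u : α × β → ℂ}
    (hu : MemLp u 2 (μ.prod ν)) :
    (∀ᵐ x ∂μ, Integrable (fun y => conj (g y) * u (x, y)) ν) ∧
    MemLp (fun x => ∫ y, conj (g y) * u (x, y) ∂ν) 2 μ ∧
    l2norm (fun x => ∫ y, conj (g y) * u (x, y) ∂ν) μ ≤ l2norm g ν * l2norm u (μ.prod ν) := by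
  have hmeas := hu.1.prodMk_left
  have hu2 : ∫⁻ x, ∫⁻ y, ‖u (x, y)‖ₑ ^ 2 ∂ν ∂μ = eLpNorm u 2 (μ.prod ν) ^ 2 := by
    rw [eLpNorm_two_sq, lintegral_prod _ (hu.1.enorm.pow_const 2)]
  have hle : eLpNorm (fun x => ∫ y, conj (g y) * u (x, y) ∂ν) 2 μ ≤
      eLpNorm g 2 ν * eLpNorm u 2 (μ.prod ν) := by
    rw [← ENNReal.pow_le_pow_left_iff two_ne_zero, mul_pow, ← hu2, eLpNorm_two_sq,
      ← lintegral_const_mul' _ _ (by finiteness [hg.2.ne])]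
    refine lintegral_mono_ae ?_
    filter_upwards [hmeas] with x hx
    exact enorm_integral_mul_sq_le hg hx
  refine ⟨?_, ⟨?_, hle.trans_lt (ENNReal.mul_lt_top hg.2 hu.2)⟩, ?_⟩
  · have hfin : ∀ᵐ x ∂μ, ∫⁻ y, ‖u (x, y)‖ₑ ^ 2 ∂ν < ⊤ := by
      refine ae_lt_top' ?_ ?_
      · exact (hu.1.enorm.pow_const 2).lintegral_prod_right'
      · rw [hu2]; exact ENNReal.pow_ne_top hu.2.ne
    filter_upwards [hmeas, hfin] with x hx hf
    have h1 : MemLp (fun y => u (x, y)) 2 ν := by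
      refine ⟨hx, ?_⟩
      rw [← eLpNorm_two_sq] at hf
      exact lt_top_iff_ne_top.2 fun h => by simp [h] at hf
    have h2 : MemLp (fun y => conj (g y)) 2 ν := hg.star
    exact h2.integrable_mul h1
  · refine AEStronglyMeasurable.integral_prod_right' (f := fun z : α × β => conj (g z.2) * u z) ?_
    refine AEStronglyMeasurable.mul ?_ hu.1
    exact Complex.continuous_conj.comp_aestronglyMeasurable hg.1.comp_snd
  · rw [l2norm, l2norm, l2norm, ← ENNReal.toReal_mul]
    exact ENNReal.toReal_mono (ENNReal.mul_ne_top hg.2.ne hu.2.ne) hle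

theorem memLp_mul_prod [SFinite μ] {v : α → ℂ} {g : β → ℂ} (hv : MemLp v 2 μ) (hg : MemLp g 2 ν) :
    MemLp (fun z : α × β => g z.2 * v z.1) 2 (μ.prod ν) ∧
    l2norm (fun z : α × β => g z.2 * v z.1) (μ.prod ν) = l2norm g ν * l2norm v μ := by
  have hle : eLpNorm (fun z : α × β => g z.2 * v z.1) 2 (μ.prod ν) =
      eLpNorm g 2 ν * eLpNorm v 2 μ := by
    refine (ENNReal.pow_right_strictMono two_ne_zero).injective ?_
    simp only [mul_pow, eLpNorm_two_sq, enorm_mul]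
    rw [mul_comm, ← lintegral_prod_mul (hv.1.enorm.pow_const 2) (hg.1.enorm.pow_const 2)]
    simp only [mul_comm]
  refine ⟨⟨hg.1.comp_snd.mul hv.1.comp_fst, ?_⟩, ?_⟩
  · rw [hle]; exact ENNReal.mul_lt_top hg.2 hv.2
  · rw [l2norm, l2norm, l2norm, ← ENNReal.toReal_mul, hle]

end Product

/-! ### Inserting and removing one momentum variable -/

section Insert

variable {d m : ℕ}

/-- `(K, k) ↦ (k₁, …, k, …, kₘ)`, with `k` inserted at position `j`. -/
noncomputable def insertEquiv (d : ℕ) {m : ℕ} (j : Fin (m + 1)) :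
    (Fin m → Space d) × Space d ≃ᵐ (Fin (m + 1) → Space d) :=
  MeasurableEquiv.prodComm.trans (MeasurableEquiv.piFinSuccAbove (fun _ => Space d) j).symm

theorem insertEquiv_apply (j : Fin (m + 1)) (K : Fin m → Space d) (k : Space d) :
    insertEquiv d j (K, k) = j.insertNth k K := rfl

theorem measurePreserving_insertEquiv (j : Fin (m + 1)) :
    MeasurePreserving (insertEquiv d j) (volume.prod volume) volume :=
  (volume_preserving_piFinSuccAbove (fun _ : Fin (m + 1) => Space d) j).symm.comp
    Measure.measurePreserving_swap

theorem insertEquiv_last (K : Fin m → Space d) (k : Space d) :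
    insertEquiv d (Fin.last m) (K, k) = Fin.snoc K k := by
  rw [insertEquiv_apply, Fin.insertNth_last']

/-- Inserting at position `j` agrees with appending, up to a permutation. -/
theorem exists_perm_insertNth (j : Fin (m + 1)) :
    ∃ σ : Equiv.Perm (Fin (m + 1)), ∀ (K : Fin m → Space d) k,
      (Fin.snoc K k : Fin (m + 1) → Space d) ∘ σ = j.insertNth k K := by
  refine ⟨(finSuccEquiv' j).trans finSuccEquivLast.symm, fun K k => ?_⟩
  rw [Fin.eq_insertNth_iff]
  constructor
  · simp
  · funext i
    simp [Fin.removeNth]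

/-- Permuting the first variables before appending one more is a permutation of all variables. -/
theorem exists_perm_snoc (σ : Equiv.Perm (Fin m)) :
    ∃ σ' : Equiv.Perm (Fin (m + 1)), ∀ (K : Fin m → Space d) k,
      (Fin.snoc K k : Fin (m + 1) → Space d) ∘ σ' = Fin.snoc (K ∘ σ) k := by
  refine ⟨finSuccEquivLast.trans ((Equiv.optionCongr σ).trans finSuccEquivLast.symm),
    fun K k => ?_⟩
  rw [← Fin.insertNth_last', ← Fin.insertNth_last', Fin.eq_insertNth_iff]
  constructor
  · simp
  · funext i
    simp [Fin.removeNth]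

/-- Removing a variable after a permutation is removing another one, up to a permutation of the
remaining variables. -/
theorem exists_perm_removeNth (σ : Equiv.Perm (Fin (m + 1))) (j : Fin (m + 1)) :
    ∃ τ : Equiv.Perm (Fin m), ∀ K : Fin (m + 1) → Space d,
      j.removeNth (K ∘ σ) = (σ j).removeNth K ∘ τ := by
  refine ⟨((finSuccAboveEquiv j).trans (σ.subtypeEquiv fun a => ?_)).trans
    (finSuccAboveEquiv (σ j)).symm, fun K => ?_⟩
  · simp
  · funext i
    simp only [Fin.removeNth, Function.comp_apply, Equiv.trans_apply]
    congr 1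
    have h := (finSuccAboveEquiv (σ j)).apply_symm_apply
      (σ.subtypeEquiv (p := fun a => a ≠ j) (q := fun a => a ≠ σ j) (fun a => by simp)
        (finSuccAboveEquiv j i))
    have h2 := congrArg Subtype.val h
    exact h2.symm

/-- By symmetry the position of the inserted variable is irrelevant for a Fock vector. -/
theorem comp_insertNth (φ : Fock d) (j : Fin (m + 1)) :
    (fun z : (Fin m → Space d) × Space d => comp φ (m + 1) (insertEquiv d j z)) =ᵐ[volume.prod volume]
      fun z => comp φ (m + 1) (insertEquiv d (Fin.last m) z) := by
  obtain ⟨σ, hσ⟩ := exists_perm_insertNth (d := d) j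
  have h := (measurePreserving_insertEquiv (d := d) (Fin.last m)).quasiMeasurePreserving.ae
    (comp_perm φ σ)
  filter_upwards [h] with z hz
  rw [← hz, ← Prod.mk.eta (p := z), insertEquiv_last, hσ, insertEquiv_apply]

end Insert

/-! ### Annihilation and creation operators -/

section FieldOperators

variable {d m : ℕ} {ħ mf : ℝ} {g g' : Space d → ℂ}

/-- The integral in the annihilation operator. -/
noncomputable def annInt (g : Space d → ℂ) (ψ : Fock d) (m : ℕ) (K : Fin m → Space d) : ℂ :=
  ∫ k, conj (g k) * comp ψ (m + 1) (Fin.snoc K k)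

/-- One term in the creation operator. -/
noncomputable def creTerm (g : Space d → ℂ) (ψ : Fock d) (m : ℕ) (j : Fin (m + 1))
    (K : Fin (m + 1) → Space d) : ℂ :=
  g (K j) * comp ψ m (j.removeNth K)

theorem memLp_comp_insertEquiv (ψ : Fock d) (j : Fin (m + 1)) :
    MemLp (fun z => comp ψ (m + 1) (insertEquiv d j z)) 2 (volume.prod volume) :=
  (memLp_comp ψ (m + 1)).comp_measurePreserving (measurePreserving_insertEquiv j)

theorem annInt_spec (hg : MemLp g 2) (ψ : Fock d) (m : ℕ) :
    (∀ᵐ K : Fin m → Space d, Integrable fun k => conj (g k) * comp ψ (m + 1) (Fin.snoc K k)) ∧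
    MemLp (annInt g ψ m) 2 ∧ l2norm (annInt g ψ m) ≤ l2norm g * l2norm (comp ψ (m + 1)) := by
  have h := memLp_integral_mul hg (memLp_comp_insertEquiv ψ (Fin.last m))
  rw [l2norm_comp_measurePreserving (memLp_comp ψ (m + 1))
    (measurePreserving_insertEquiv (Fin.last m))] at h
  simp only [insertEquiv_last] at h
  exact h

theorem creTerm_spec (hg : MemLp g 2) (ψ : Fock d) (m : ℕ) (j : Fin (m + 1)) :
    MemLp (creTerm g ψ m j) 2 ∧ l2norm (creTerm g ψ m j) = l2norm g * l2norm (comp ψ m) := by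
  have h := memLp_mul_prod (memLp_comp ψ m) hg
  have he : MeasurePreserving (insertEquiv d j).symm volume (volume.prod volume) :=
    (measurePreserving_insertEquiv j).symm
  refine ⟨h.1.comp_measurePreserving he, ?_⟩
  rw [← h.2, ← l2norm_comp_measurePreserving h.1 he]
  rfl

theorem annInt_perm (g : Space d → ℂ) (ψ : Fock d) (m : ℕ) (σ : Equiv.Perm (Fin m)) :
    (fun K => annInt g ψ m (K ∘ σ)) =ᵐ[volume] annInt g ψ m := by
  obtain ⟨σ', h⟩ := exists_perm_snoc (d := d) σ
  filter_upwards [ae_snoc (comp_perm ψ σ')] with K hK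
  refine integral_congr_ae ?_
  filter_upwards [hK] with k hk
  rw [← hk, h]

theorem sum_creTerm_perm (g : Space d → ℂ) (ψ : Fock d) (m : ℕ) (σ : Equiv.Perm (Fin (m + 1))) :
    (fun K => ∑ j, creTerm g ψ m j (K ∘ σ)) =ᵐ[volume] fun K => ∑ j, creTerm g ψ m j K := by
  have h : ∀ j : Fin (m + 1), ∀ᵐ K : Fin (m + 1) → Space d,
      creTerm g ψ m j (K ∘ σ) = creTerm g ψ m (σ j) K := by
    intro j
    obtain ⟨τ, hτ⟩ := exists_perm_removeNth (d := d) σ j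
    filter_upwards [ae_removeNth (σ j) (comp_perm ψ τ)] with K hK
    rw [creTerm, hτ, hK]
    rfl
  filter_upwards [ae_all_iff.2 h] with K hK
  rw [← Equiv.sum_comp σ fun j => creTerm g ψ m j K]
  exact Finset.sum_congr rfl fun j _ => hK j

/-- On each sector the interaction is bounded relative to the field energy, since the number of
bosons is bounded by a multiple of the field energy. -/
theorem sector_bound (hħ : 0 < ħ) (hmf : 0 < mf) {ε : ℝ} (hε : 0 < ε) {p : Fock d × Fock d}
    (hp : p ∈ (secondQuant ħ (dispersion mf)).graph) (m : ℕ) :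
    ħ * (m + 1) * l2norm (comp p.1 m) ^ 2 ≤
      ε * l2norm (comp p.2 m) ^ 2 + (ħ + 1 / (4 * ε * mf ^ 2)) * l2norm (comp p.1 m) ^ 2 := by
  rw [mem_graph_secondQuant] at hp
  have h1 : ħ * mf * m * l2norm (comp p.1 m) ≤ l2norm (comp p.2 m) := by
    have hpos : 0 ≤ ħ * mf * m := by positivity
    have h2 : l2norm (fun K => ((ħ * mf * m : ℝ) : ℂ) * comp p.1 m K) ≤
        1 * l2norm (comp p.2 m) := by
      refine l2norm_le_mul zero_le_one (memLp_comp _ _) ?_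
      filter_upwards [hp m] with K hK
      rw [hK, one_mul, norm_mul, norm_mul, Complex.norm_real, Complex.norm_real,
        Real.norm_of_nonneg hpos, Real.norm_of_nonneg (fieldEnergy_nonneg hħ K)]
      exact mul_le_mul_of_nonneg_right (le_fieldEnergy hħ K) (norm_nonneg _)
    rw [l2norm_const_mul, Complex.norm_real, Real.norm_of_nonneg hpos] at h2
    linarith
  have h2 : (ħ * mf * m * l2norm (comp p.1 m)) ^ 2 ≤ l2norm (comp p.2 m) ^ 2 :=
    pow_le_pow_left₀ (mul_nonneg (by positivity) (l2norm_nonneg _ _)) h1 2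
  have h3 : ħ * m ≤ ε * (ħ * mf * m) ^ 2 + 1 / (4 * ε * mf ^ 2) := by
    have h4 : ε * (ħ * mf * m) ^ 2 + 1 / (4 * ε * mf ^ 2) - ħ * m =
        (2 * ε * ħ * mf ^ 2 * m - 1) ^ 2 / (4 * ε * mf ^ 2) := by
      field_simp
      ring
    have h5 : 0 ≤ (2 * ε * ħ * mf ^ 2 * m - 1) ^ 2 / (4 * ε * mf ^ 2) := by positivity
    linarith
  nlinarith [mul_le_mul_of_nonneg_right h3 (sq_nonneg (l2norm (comp p.1 m))),
    mul_le_mul_of_nonneg_left h2 hε.le]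

/-- The common properties of annihilation and creation operators used below: they are defined on
the domain of the field energy, are infinitesimally bounded with respect to it, and depend
additively on the form factor. -/
structure IsFieldOperator (ħ mf : ℝ) (A : (Space d → ℂ) → Fock d →ₗ.[ℂ] Fock d) : Prop where
  exists_mem : ∀ {g}, MemLp g 2 → ∀ {p}, p ∈ (secondQuant ħ (dispersion mf)).graph →
    ∃ η, (p.1, η) ∈ (A g).graph
  bound : ∀ {g}, MemLp g 2 → ∀ {p}, p ∈ (secondQuant ħ (dispersion mf)).graph →
    ∀ {η}, (p.1, η) ∈ (A g).graph → ∀ {ε : ℝ}, 0 < ε →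
    ‖η‖ ^ 2 ≤ l2norm g ^ 2 * (ε * ‖p.2‖ ^ 2 + (ħ + 1 / (4 * ε * mf ^ 2)) * ‖p.1‖ ^ 2)
  sub_mem : ∀ {g g'} {ψ η η' : Fock d}, (ψ, η) ∈ (A g).graph → (ψ, η') ∈ (A g').graph →
    (ψ, η - η') ∈ (A (g - g')).graph

theorem mem_graph_annihilation {ψ φ : Fock d} :
    (ψ, φ) ∈ (annihilation ħ g).graph ↔ IsAnnihilation ħ g ψ φ := by
  rw [graph_annihilation]; rfl

theorem mem_graph_creation {ψ φ : Fock d} :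
    (ψ, φ) ∈ (creation ħ g).graph ↔ ∀ m, comp φ m =ᵐ[volume] creationComp ħ g ψ m := by
  rw [graph_creation]; rfl

theorem hasSum_sector_bound (c ε C : ℝ) (p : Fock d × Fock d) :
    HasSum (fun m => c * (ε * l2norm (comp p.2 m) ^ 2 + C * l2norm (comp p.1 m) ^ 2))
      (c * (ε * ‖p.2‖ ^ 2 + C * ‖p.1‖ ^ 2)) :=
  (((hasSum_norm_sq p.2).mul_left ε).add ((hasSum_norm_sq p.1).mul_left C)).mul_left c

theorem annihilation_sector_le (hħ : 0 < ħ) (hmf : 0 < mf) {ε : ℝ} (hε : 0 < ε)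
    (hg : MemLp g 2) {p : Fock d × Fock d}
    (hp : p ∈ (secondQuant ħ (dispersion mf)).graph) (m : ℕ) :
    l2norm (fun K => (√(ħ * (m + 1)) : ℂ) * annInt g p.1 m K) ^ 2 ≤
      l2norm g ^ 2 * (ε * l2norm (comp p.2 (m + 1)) ^ 2 +
        (ħ + 1 / (4 * ε * mf ^ 2)) * l2norm (comp p.1 (m + 1)) ^ 2) := by
  have h1 := sector_bound hħ hmf hε hp (m + 1)
  have h2 : (0 : ℝ) ≤ ħ * (m + 1) := by positivity
  have h3 := pow_le_pow_left₀ (l2norm_nonneg _ _) (annInt_spec hg p.1 m).2.2 2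
  rw [l2norm_const_mul, Complex.norm_real, Real.norm_of_nonneg (Real.sqrt_nonneg _), mul_pow,
    Real.sq_sqrt h2]
  have h4 : ħ * (m + 1) * l2norm (comp p.1 (m + 1)) ^ 2 ≤
      ħ * ((m + 1 : ℕ) + 1) * l2norm (comp p.1 (m + 1)) ^ 2 := by
    refine mul_le_mul_of_nonneg_right (mul_le_mul_of_nonneg_left ?_ hħ.le) (sq_nonneg _)
    push_cast; linarith
  calc _ ≤ ħ * (m + 1) * (l2norm g * l2norm (comp p.1 (m + 1))) ^ 2 := by gcongr
    _ = l2norm g ^ 2 * (ħ * (m + 1) * l2norm (comp p.1 (m + 1)) ^ 2) := by ring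
    _ ≤ _ := by
        have h5 := h4.trans h1
        gcongr

theorem annihilation_exists_mem (hħ : 0 < ħ) (hmf : 0 < mf) (hg : MemLp g 2)
    {p : Fock d × Fock d} (hp : p ∈ (secondQuant ħ (dispersion mf)).graph) :
    ∃ η, (p.1, η) ∈ (annihilation ħ g).graph := by
  have h0 := fun m => annihilation_sector_le (ε := 1) hħ hmf (by norm_num) hg hp m
  have h2 := (hasSum_sector_bound (l2norm g ^ 2) 1 (ħ + 1 / (4 * 1 * mf ^ 2)) p).summable
  have h3 := (summable_nat_add_iff 1).2 h2
  have h1 := Summable.of_nonneg_of_le (fun m => sq_nonneg _) h0 h3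
  obtain ⟨η, hη⟩ := exists_fock (fun m K => (√(ħ * (m + 1)) : ℂ) * annInt g p.1 m K)
    (fun m => (annInt_spec hg p.1 m).2.1.const_mul _)
    (fun m σ => by filter_upwards [annInt_perm g p.1 m σ] with K hK; rw [hK]) h1
  exact ⟨η, mem_graph_annihilation.2 fun m => ⟨(annInt_spec hg p.1 m).1, hη m⟩⟩

theorem annihilation_bound (hħ : 0 < ħ) (hmf : 0 < mf) (hg : MemLp g 2) {p : Fock d × Fock d}
    (hp : p ∈ (secondQuant ħ (dispersion mf)).graph) {η : Fock d}
    (hη : (p.1, η) ∈ (annihilation ħ g).graph) {ε : ℝ} (hε : 0 < ε) :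
    ‖η‖ ^ 2 ≤ l2norm g ^ 2 * (ε * ‖p.2‖ ^ 2 + (ħ + 1 / (4 * ε * mf ^ 2)) * ‖p.1‖ ^ 2) := by
  rw [mem_graph_annihilation] at hη
  have hb := hasSum_sector_bound (l2norm g ^ 2) ε (ħ + 1 / (4 * ε * mf ^ 2)) p
  have hb1 := (hasSum_nat_add_iff' 1).2 hb
  refine (norm_sq_le_of_hasSum hb1 fun m => ?_).trans ?_
  · rw [l2norm_congr (hη m).2]
    exact annihilation_sector_le hħ hmf hε hg hp m
  · rw [sub_le_self_iff]
    exact Finset.sum_nonneg fun i _ => by positivity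

theorem isFieldOperator_annihilation (hħ : 0 < ħ) (hmf : 0 < mf) :
    IsFieldOperator (d := d) ħ mf (annihilation ħ) where
  exists_mem hg _ hp := annihilation_exists_mem hħ hmf hg hp
  bound hg _ hp _ hη _ hε := annihilation_bound hħ hmf hg hp hη hε
  sub_mem := by
    intro g g' ψ η η' h h'
    rw [mem_graph_annihilation] at *
    intro m
    have hae : ∀ K : Fin m → Space d,
        (fun k => conj ((g - g') k) * comp ψ (m + 1) (Fin.snoc K k)) =
          fun k => conj (g k) * comp ψ (m + 1) (Fin.snoc K k) -
            conj (g' k) * comp ψ (m + 1) (Fin.snoc K k) := fun K => by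
      funext k
      rw [Pi.sub_apply, map_sub, sub_mul]
    refine ⟨?_, ?_⟩
    · filter_upwards [(h m).1, (h' m).1] with K h1 h2
      rw [hae]
      exact h1.sub h2
    · filter_upwards [(h m).1, (h' m).1, (h m).2, (h' m).2, comp_sub η η' m] with K h1 h2 h3 h4 h5
      rw [h5, Pi.sub_apply, h3, h4, hae, integral_sub h1 h2, mul_sub]

theorem creation_sector_le (hħ : 0 < ħ) (hmf : 0 < mf) {ε : ℝ} (hε : 0 < ε)
    (hg : MemLp g 2) {p : Fock d × Fock d}
    (hp : p ∈ (secondQuant ħ (dispersion mf)).graph) (m : ℕ) :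
    l2norm (creationComp ħ g p.1 (m + 1)) ^ 2 ≤
      l2norm g ^ 2 * (ε * l2norm (comp p.2 m) ^ 2 +
        (ħ + 1 / (4 * ε * mf ^ 2)) * l2norm (comp p.1 m) ^ 2) := by
  have h1 := sector_bound hħ hmf hε hp m
  have h2 : (0 : ℝ) < m + 1 := by positivity
  have h3 : l2norm (fun K => ∑ j, creTerm g p.1 m j K) ≤
      (m + 1) * (l2norm g * l2norm (comp p.1 m)) := by
    refine (l2norm_sum_le Finset.univ fun j => (creTerm_spec hg p.1 m j).1).trans ?_
    simp only [fun j => (creTerm_spec hg p.1 m j).2]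
    simp
  have h4 : l2norm (creationComp ħ g p.1 (m + 1)) =
      (√ħ / √(m + 1 : ℝ)) * l2norm (fun K => ∑ j, creTerm g p.1 m j K) := by
    have h5 := l2norm_const_mul (μ := volume) ((√ħ / √(m + 1 : ℝ) : ℝ) : ℂ)
      (fun K => ∑ j, creTerm g p.1 m j K)
    rw [Complex.norm_real, Real.norm_of_nonneg (by positivity)] at h5
    rw [← h5]
    push_cast
    rfl
  calc _ ≤ ((√ħ / √(m + 1 : ℝ)) * ((m + 1) * (l2norm g * l2norm (comp p.1 m)))) ^ 2 := by
        rw [h4]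
        have h5 := l2norm_nonneg (fun K => ∑ j, creTerm g p.1 m j K) volume
        gcongr
    _ = l2norm g ^ 2 * (ħ * (m + 1) * l2norm (comp p.1 m) ^ 2) := by
        rw [mul_pow, div_pow, Real.sq_sqrt hħ.le, Real.sq_sqrt h2.le]
        field_simp
    _ ≤ _ := by gcongr

theorem memLp_creationComp (hg : MemLp g 2) (ψ : Fock d) (m : ℕ) :
    MemLp (creationComp ħ g ψ m) 2 := by
  cases m with
  | zero => exact MemLp.zero
  | succ m => exact (memLp_finsetSum Finset.univ fun j _ => (creTerm_spec hg ψ m j).1).const_mul _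

theorem creationComp_perm (g : Space d → ℂ) (ψ : Fock d) (m : ℕ) (σ : Equiv.Perm (Fin m)) :
    (fun K => creationComp ħ g ψ m (K ∘ σ)) =ᵐ[volume] creationComp ħ g ψ m := by
  cases m with
  | zero => rfl
  | succ m =>
    filter_upwards [sum_creTerm_perm g ψ m σ] with K hK
    exact congrArg ((√ħ / √(m + 1 : ℝ) : ℂ) * ·) hK

theorem creation_exists_mem (hħ : 0 < ħ) (hmf : 0 < mf) (hg : MemLp g 2) {p : Fock d × Fock d}
    (hp : p ∈ (secondQuant ħ (dispersion mf)).graph) :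
    ∃ η, (p.1, η) ∈ (creation ħ g).graph := by
  have h0 := fun m => creation_sector_le (ε := 1) hħ hmf (by norm_num) hg hp m
  have h2 := (hasSum_sector_bound (l2norm g ^ 2) 1 (ħ + 1 / (4 * 1 * mf ^ 2)) p).summable
  have h1 := Summable.of_nonneg_of_le (fun m => sq_nonneg _) h0 h2
  have h3 : Summable fun m => l2norm (creationComp ħ g p.1 m) ^ 2 :=
    (summable_nat_add_iff 1).1 h1
  obtain ⟨η, hη⟩ := exists_fock (creationComp ħ g p.1) (memLp_creationComp hg p.1)
    (creationComp_perm g p.1) h3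
  exact ⟨η, mem_graph_creation.2 hη⟩

theorem creation_bound (hħ : 0 < ħ) (hmf : 0 < mf) (hg : MemLp g 2) {p : Fock d × Fock d}
    (hp : p ∈ (secondQuant ħ (dispersion mf)).graph) {η : Fock d}
    (hη : (p.1, η) ∈ (creation ħ g).graph) {ε : ℝ} (hε : 0 < ε) :
    ‖η‖ ^ 2 ≤ l2norm g ^ 2 * (ε * ‖p.2‖ ^ 2 + (ħ + 1 / (4 * ε * mf ^ 2)) * ‖p.1‖ ^ 2) := by
  rw [mem_graph_creation] at hη
  have h0 : l2norm (comp η 0) = 0 := by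
    rw [l2norm_congr (hη 0)]
    exact congrArg ENNReal.toReal eLpNorm_zero
  have h1 := (hasSum_nat_add_iff' 1).2 (hasSum_norm_sq η)
  rw [Finset.sum_range_one, h0, zero_pow two_ne_zero, sub_zero] at h1
  have h2 : ∀ m, l2norm (comp η (m + 1)) ^ 2 ≤
      l2norm g ^ 2 * (ε * l2norm (comp p.2 m) ^ 2 +
        (ħ + 1 / (4 * ε * mf ^ 2)) * l2norm (comp p.1 m) ^ 2) := fun m => by
    rw [l2norm_congr (hη (m + 1))]
    exact creation_sector_le hħ hmf hε hg hp m
  exact hasSum_le h2 h1 (hasSum_sector_bound _ _ _ p)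

theorem isFieldOperator_creation (hħ : 0 < ħ) (hmf : 0 < mf) :
    IsFieldOperator (d := d) ħ mf (creation ħ) where
  exists_mem hg _ hp := creation_exists_mem hħ hmf hg hp
  bound hg _ hp _ hη _ hε := creation_bound hħ hmf hg hp hη hε
  sub_mem := by
    intro g g' ψ η η' h h'
    rw [mem_graph_creation] at *
    intro m
    cases m with
    | zero =>
      filter_upwards [h 0, h' 0, comp_sub η η' 0] with K h1 h2 h3
      rw [h3, Pi.sub_apply, h1, h2]
      simp [creationComp]
    | succ m =>
      filter_upwards [h (m + 1), h' (m + 1), comp_sub η η' (m + 1)] with K h1 h2 h3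
      rw [h3, Pi.sub_apply, h1, h2]
      simp only [creationComp, Pi.sub_apply, sub_mul, Finset.sum_sub_distrib, mul_sub]

/-- All terms of the creation operator have the same pairing with a Fock vector, because the latter
is symmetric. -/
theorem integral_creTerm (hg : MemLp g 2) (ψ φ : Fock d) (m : ℕ) (j : Fin (m + 1)) :
    ∫ K, conj (creTerm g ψ m j K) * comp φ (m + 1) K =
      ∫ K, conj (comp ψ m K) * annInt g φ m K := by
  have h1 := (measurePreserving_insertEquiv (d := d) j).integral_comp'
    fun K => conj (creTerm g ψ m j K) * comp φ (m + 1) K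
  have h2 : ∫ z : (Fin m → Space d) × Space d, conj (creTerm g ψ m j (insertEquiv d j z)) *
      comp φ (m + 1) (insertEquiv d j z) ∂(volume.prod volume) =
      ∫ z : (Fin m → Space d) × Space d, conj (g z.2 * comp ψ m z.1) *
        comp φ (m + 1) (insertEquiv d (Fin.last m) z) ∂(volume.prod volume) := by
    refine integral_congr_ae ?_
    filter_upwards [comp_insertNth φ j] with z hz
    rw [hz, creTerm, ← Prod.mk.eta (p := z), insertEquiv_apply]
    simp
  have h3 : Integrable (fun z : (Fin m → Space d) × Space d => conj (g z.2 * comp ψ m z.1) *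
      comp φ (m + 1) (insertEquiv d (Fin.last m) z)) (volume.prod volume) := by
    have h4 := (memLp_mul_prod (memLp_comp ψ m) hg).1.star
    exact h4.integrable_mul (memLp_comp_insertEquiv φ (Fin.last m))
  rw [← h1, h2, integral_prod _ h3]
  refine integral_congr_ae (Filter.Eventually.of_forall fun K => ?_)
  simp only [insertEquiv_last, annInt, ← integral_const_mul]
  refine integral_congr_ae (Filter.Eventually.of_forall fun k => ?_)
  simp only [map_mul]
  ring

/-- Creation and annihilation operators with the same form factor are formally adjoint. -/
theorem inner_creation_eq (hħ : 0 < ħ) (hg : MemLp g 2) {ψ η φ ζ : Fock d}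
    (hη : (ψ, η) ∈ (creation ħ g).graph) (hζ : (φ, ζ) ∈ (annihilation ħ g).graph) :
    ⟪η, φ⟫_ℂ = ⟪ψ, ζ⟫_ℂ := by
  rw [mem_graph_creation] at hη
  rw [mem_graph_annihilation] at hζ
  have h0 : ∫ K, conj (comp η 0 K) * comp φ 0 K = 0 := by
    rw [← integral_zero (Fin 0 → Space d) ℂ]
    refine integral_congr_ae ?_
    filter_upwards [hη 0] with K hK
    rw [hK]
    simp [creationComp]
  have h1 := (hasSum_nat_add_iff' 1).2 (hasSum_inner η φ)
  rw [Finset.sum_range_one, h0, sub_zero] at h1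
  have key : ∀ m : ℕ, ∫ K, conj (comp η (m + 1) K) * comp φ (m + 1) K =
      ∫ K, conj (comp ψ m K) * comp ζ m K := by
    intro m
    have hint : ∀ j : Fin (m + 1), Integrable fun K =>
        conj (creTerm g ψ m j K) * comp φ (m + 1) K := fun j =>
      (creTerm_spec hg ψ m j).1.star.integrable_mul (memLp_comp φ (m + 1))
    have hr : √(ħ * (m + 1)) = √ħ / √(m + 1 : ℝ) * (m + 1) := by
      have h2 : (0 : ℝ) < m + 1 := by positivity
      have h3 := Real.mul_self_sqrt h2.le
      rw [Real.sqrt_mul hħ.le]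
      field_simp
      rw [pow_two, h3]
    have e1 : ∫ K, conj (comp ψ m K) * comp ζ m K =
        (√(ħ * (m + 1)) : ℂ) * ∫ K, conj (comp ψ m K) * annInt g φ m K := by
      rw [← integral_const_mul]
      refine integral_congr_ae ?_
      filter_upwards [(hζ m).2] with K hK
      rw [hK, mul_left_comm]
      rfl
    have e2 : ∫ K, conj (comp η (m + 1) K) * comp φ (m + 1) K =
        (√ħ / √(m + 1 : ℝ) : ℂ) *
          ∑ j : Fin (m + 1), ∫ K, conj (creTerm g ψ m j K) * comp φ (m + 1) K := by
      rw [← integral_finsetSum _ fun j _ => hint j, ← integral_const_mul]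
      refine integral_congr_ae ?_
      filter_upwards [hη (m + 1)] with K hK
      rw [hK, ← Finset.sum_mul, ← mul_assoc]
      congr 1
      simp [creationComp, creTerm]
    rw [e1, e2]
    simp only [integral_creTerm hg, hr]
    simp
    ring
  simp only [key] at h1
  exact h1.unique (hasSum_inner ψ ζ)

end FieldOperators

/-! ### The Fourier transform of vector-valued functions -/

section Fourier

variable {E F : Type*} [NormedAddCommGroup E] [InnerProductSpace ℝ E] [FiniteDimensional ℝ E]
  [MeasurableSpace E] [BorelSpace E] [NormedAddCommGroup F] [InnerProductSpace ℂ F]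
  [CompleteSpace F]

theorem fourier_postcompCLM (L : F →L[ℂ] F) (f : SchwartzMap E F) :
    𝓕 (SchwartzMap.postcompCLM L f) = SchwartzMap.postcompCLM L (𝓕 f) := by
  ext w
  rw [SchwartzMap.postcompCLM_apply, SchwartzMap.fourier_coe, SchwartzMap.fourier_coe,
    Real.fourier_eq, Real.fourier_eq, ← L.integral_comp_comm]
  · simp only [SchwartzMap.postcompCLM_apply, Circle.smul_def, map_smul]
  · exact (Real.fourierIntegral_convergent_iff w).2 f.integrable

/-- The Fourier transform on `L²(E; F)` commutes with bounded operators acting on the values. -/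
theorem fourier_compLpL (L : F →L[ℂ] F) (ψ : Lp F 2 (volume : Measure E)) :
    Lp.fourierTransformₗᵢ E F (L.compLpL 2 volume ψ) =
      L.compLpL 2 volume (Lp.fourierTransformₗᵢ E F ψ) := by
  have hS : ∀ f : SchwartzMap E F, L.compLpL 2 volume (f.toLp 2) =
      (SchwartzMap.postcompCLM L f).toLp 2 := by
    intro f
    apply Lp.ext
    filter_upwards [L.coeFn_compLpL (f.toLp 2 (volume : Measure E)), f.coeFn_toLp 2 volume,
      (SchwartzMap.postcompCLM L f).coeFn_toLp 2 volume] with x h1 h2 h3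
    rw [h1, h2, h3, SchwartzMap.postcompCLM_apply]
  refine DenseRange.induction_on (p := fun ψ : Lp F 2 (volume : Measure E) =>
    Lp.fourierTransformₗᵢ E F (L.compLpL 2 volume ψ) =
      L.compLpL 2 volume (Lp.fourierTransformₗᵢ E F ψ))
    (SchwartzMap.denseRange_toLpCLM (E := E) (F := F) (p := 2) ENNReal.ofNat_ne_top) ψ ?_ ?_
  · exact isClosed_eq
      ((Lp.fourierTransformₗᵢ E F).continuous.comp (L.compLpL 2 volume).continuous)
      ((L.compLpL 2 volume).continuous.comp (Lp.fourierTransformₗᵢ E F).continuous)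
  · intro f
    change 𝓕 (L.compLpL 2 volume (f.toLp 2)) = L.compLpL 2 volume (𝓕 (f.toLp 2))
    rw [hS, SchwartzMap.toLp_fourier_eq, SchwartzMap.toLp_fourier_eq, hS, fourier_postcompCLM]

end Fourier

/-! ### Graphs of fibred operators -/

theorem norm_sq_eq_integral {X F : Type*} [MeasurableSpace X] {μ : Measure X}
    [NormedAddCommGroup F] (f : Lp F 2 μ) : ‖f‖ ^ 2 = ∫ x, ‖f x‖ ^ 2 ∂μ := by
  rw [Lp.norm_def]
  exact l2norm_sq_eq_integral (Lp.memLp f)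

theorem integrable_norm_sq {X F : Type*} [MeasurableSpace X] {μ : Measure X}
    [NormedAddCommGroup F] (f : Lp F 2 μ) : Integrable (fun x => ‖f x‖ ^ 2) μ :=
  (Lp.memLp f).integrable_norm_pow two_ne_zero

/-- Every square integrable function represents a vector of the form `U⁻¹ v`. -/
theorem exists_symm_toLp {X F : Type*} [MeasurableSpace X] {μ : Measure X}
    [NormedAddCommGroup F] [InnerProductSpace ℂ F] (U : Lp F 2 μ ≃ₗᵢ[ℂ] Lp F 2 μ) {f : X → F}
    (hf : MemLp f 2 μ) : ∃ v : Lp F 2 μ, U v =ᵐ[μ] f := by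
  refine ⟨U.symm (hf.toLp f), ?_⟩
  rw [U.apply_symm_apply]
  exact hf.coeFn_toLp

section Fibres

variable {X F : Type*} [MeasurableSpace X] {μ : Measure X} [NormedAddCommGroup F]
  [InnerProductSpace ℂ F]

theorem mem_graph_fibreOp {A : X → F →ₗ.[ℂ] F} {p : Lp F 2 μ × Lp F 2 μ} :
    p ∈ (fibreOp μ A).graph ↔ ∀ᵐ x ∂μ, (p.1 x, p.2 x) ∈ (A x).graph := by
  rw [graph_fibreOp]; rfl

theorem mem_graph_mulOp {h : X → ℝ} {p : Lp F 2 μ × Lp F 2 μ} :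
    p ∈ (mulOp μ h).graph ↔ ∀ᵐ x ∂μ, p.2 x = (h x : ℂ) • p.1 x := by
  rw [mulOp, mem_graph_fibreOp]
  refine Filter.eventually_congr (Filter.Eventually.of_forall fun x => ?_)
  rw [LinearPMap.mem_graph_iff]
  constructor
  · rintro ⟨y, h1, h2⟩
    simp only at h1 h2
    rw [← h1, ← h2]
    rfl
  · intro h1
    exact ⟨⟨p.1 x, trivial⟩, rfl, h1.symm⟩

theorem mem_graph_conjOp {U : F ≃ₗᵢ[ℂ] F} {A : F →ₗ.[ℂ] F} {p : F × F} :
    p ∈ (conjOp U A).graph ↔ (U p.1, U p.2) ∈ A.graph := by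
  rw [LinearPMap.mem_graph_iff, LinearPMap.mem_graph_iff]
  constructor
  · rintro ⟨y, h1, h2⟩
    refine ⟨⟨U y, y.2⟩, congrArg U h1, ?_⟩
    rw [← h2]
    exact (U.apply_symm_apply _).symm
  · rintro ⟨y, h1, h2⟩
    have h1' : (y : F) = U p.1 := h1
    have hy : U p.1 ∈ A.domain := h1' ▸ y.2
    refine ⟨⟨p.1, hy⟩, rfl, ?_⟩
    have h3 : (⟨U p.1, hy⟩ : A.domain) = y := Subtype.ext h1.symm
    change U.symm (A ⟨U p.1, hy⟩) = p.2
    rw [h3, h2]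
    exact U.symm_apply_apply _

theorem isSymm_fibreOp {A : X → F →ₗ.[ℂ] F} (hA : ∀ x, IsSymm (A x)) : IsSymm (fibreOp μ A) := by
  intro p hp q hq
  rw [mem_graph_fibreOp] at hp hq
  rw [L2.inner_def, L2.inner_def]
  refine integral_congr_ae ?_
  filter_upwards [hp, hq] with x h1 h2
  exact hA x _ h1 _ h2

theorem isSymm_mulOp (h : X → ℝ) : IsSymm (mulOp (F := F) μ h) := by
  intro p hp q hq
  rw [mem_graph_mulOp] at hp hq
  rw [L2.inner_def, L2.inner_def]
  refine integral_congr_ae ?_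
  filter_upwards [hp, hq] with x h1 h2
  simp only [h1, h2, inner_smul_left, inner_smul_right, Complex.conj_ofReal]

end Fibres

/-! ### The free Hamiltonian -/

section Free

variable {d n : ℕ} {ħ mf : ℝ} {c : Fin n → Kinematics} {M : Fin n → ℝ}

/-- The Fourier transform on the Hilbert space, in the variable `X`. -/
noncomputable abbrev FT (d n : ℕ) : Hilb d n ≃ₗᵢ[ℂ] Hilb d n :=
  Lp.fourierTransformₗᵢ (Config d n) (Fock d)

/-- The symbol `fⱼ(2πħ ξⱼ)` of the kinetic energy of the `j`-th particle. -/
noncomputable def kineticSymbol (ħ : ℝ) (c : Fin n → Kinematics) (M : Fin n → ℝ) (j : Fin n)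
    (ξ : Config d n) : ℝ :=
  kineticEnergy (c j) (M j) ((2 * Real.pi * ħ) • ξ j)

theorem kineticEnergy_nonneg (c : Kinematics) {M : ℝ} (hM : 0 < M) (p : Space d) :
    0 ≤ kineticEnergy c M p := by
  cases c
  · exact Real.sqrt_nonneg _
  · exact div_nonneg (sq_nonneg _) (by linarith)

theorem continuous_kineticSymbol (j : Fin n) :
    Continuous (kineticSymbol (d := d) ħ c M j) := by
  unfold kineticSymbol kineticEnergy
  cases c j <;> simp only <;> fun_prop

theorem kineticSymbol_nonneg (hM : ∀ j, 0 < M j) (j : Fin n) (ξ : Config d n) :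
    0 ≤ kineticSymbol ħ c M j ξ := kineticEnergy_nonneg _ (hM j) _

/-- On the Fourier side a partial sum of the kinetic energies is multiplication by the sum of the
symbols; since these are nonnegative, the maximal domain of the latter is the intersection of the
maximal domains of the summands. -/
theorem mem_graph_sum_momentumOp (hM : ∀ j, 0 < M j) (s : Finset (Fin n))
    {p : Hilb d n × Hilb d n} :
    p ∈ (∑ j ∈ s, momentumOp (d := d) (n := n) ħ (kineticEnergy (c j) (M j)) j).graph ↔
      ∀ᵐ ξ, FT d n p.2 ξ = ((∑ j ∈ s, kineticSymbol ħ c M j ξ : ℝ) : ℂ) • FT d n p.1 ξ := by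
  induction s using Finset.induction_on generalizing p with
  | empty =>
    rw [Finset.sum_empty, LinearPMap.mem_graph_iff]
    simp only [Finset.sum_empty, Complex.ofReal_zero, zero_smul]
    constructor
    · rintro ⟨y, h1, h2⟩
      have h3 : p.2 = 0 := h2.symm
      rw [h3, map_zero]
      exact Lp.coeFn_zero (Fock d) 2 (volume : Measure (Config d n))
    · intro h
      have h1 : FT d n p.2 = 0 := Lp.ext (Filter.EventuallyEq.trans h
        (Lp.coeFn_zero (Fock d) 2 (volume : Measure (Config d n))).symm)
      have h2 : p.2 = 0 := (FT d n).map_eq_zero_iff.1 h1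
      exact ⟨⟨p.1, trivial⟩, rfl, h2.symm⟩
  | insert a s ha ih =>
    rw [Finset.sum_insert ha, mem_graph_add]
    simp only [Finset.sum_insert ha]
    constructor
    · rintro ⟨u, v, hu, hv, huv⟩
      rw [ih] at hv
      rw [momentumOp, mem_graph_conjOp, mem_graph_mulOp] at hu
      rw [huv, map_add]
      filter_upwards [hu, hv, Lp.coeFn_add (FT d n u) (FT d n v)] with ξ h1 h2 h3
      rw [h3, Pi.add_apply, h2, h1, Complex.ofReal_add, add_smul]
      rfl
    · intro h
      have hle : ∀ᵐ ξ, ‖(kineticSymbol ħ c M a ξ : ℂ) • FT d n p.1 ξ‖ ≤ 1 * ‖FT d n p.2 ξ‖ := by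
        filter_upwards [h] with ξ hξ
        have h0 := kineticSymbol_nonneg (ħ := ħ) (c := c) hM a ξ
        have h1 : 0 ≤ ∑ j ∈ s, kineticSymbol ħ c M j ξ :=
          Finset.sum_nonneg fun j _ => kineticSymbol_nonneg hM j ξ
        rw [hξ, one_mul, norm_smul, norm_smul, Complex.norm_real, Complex.norm_real,
          Real.norm_of_nonneg h0, Real.norm_of_nonneg (by linarith)]
        gcongr
        linarith
      have hmem : MemLp (fun ξ => (kineticSymbol ħ c M a ξ : ℂ) • FT d n p.1 ξ) 2 volume := by
        have hz : AEStronglyMeasurable (fun ξ => (kineticSymbol (d := d) ħ c M a ξ : ℂ)) volume :=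
          (Complex.continuous_ofReal.comp (continuous_kineticSymbol a)).aestronglyMeasurable
        exact (Lp.memLp (FT d n p.2)).of_le_mul (hz.smul (Lp.memLp (FT d n p.1)).1) hle
      obtain ⟨w, hw⟩ := exists_symm_toLp (FT d n) hmem
      refine ⟨w, p.2 - w, ?_, ?_, by abel⟩
      · rw [momentumOp, mem_graph_conjOp, mem_graph_mulOp]
        exact hw
      · rw [ih]
        simp only
        rw [map_sub]
        filter_upwards [h, Lp.coeFn_sub (FT d n p.2) (FT d n w), hw] with ξ h1 h2 h3
        rw [h2, Pi.sub_apply, h1, h3, Complex.ofReal_add, add_smul, add_sub_cancel_left]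

/-- The symbol `∑ⱼ fⱼ(2πħ ξⱼ)` of the total kinetic energy. -/
noncomputable def totalSymbol (ħ : ℝ) (c : Fin n → Kinematics) (M : Fin n → ℝ)
    (ξ : Config d n) : ℝ :=
  ∑ j, kineticSymbol ħ c M j ξ

theorem continuous_totalSymbol : Continuous (totalSymbol (d := d) ħ c M) :=
  continuous_finsetSum _ fun j _ => continuous_kineticSymbol j

theorem totalSymbol_nonneg (hM : ∀ j, 0 < M j) (ξ : Config d n) : 0 ≤ totalSymbol ħ c M ξ :=
  Finset.sum_nonneg fun j _ => kineticSymbol_nonneg hM j ξ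

theorem mem_graph_hamiltonian01 (hM : ∀ j, 0 < M j) {p : Hilb d n × Hilb d n} :
    p ∈ (hamiltonian01 (d := d) (n := n) ħ c M).graph ↔
      ∀ᵐ ξ, FT d n p.2 ξ = (totalSymbol ħ c M ξ : ℂ) • FT d n p.1 ξ :=
  mem_graph_sum_momentumOp hM Finset.univ

theorem isSymm_hamiltonian01 (hM : ∀ j, 0 < M j) :
    IsSymm (hamiltonian01 (d := d) (n := n) ħ c M) := by
  intro p hp q hq
  rw [mem_graph_hamiltonian01 hM, ← mem_graph_mulOp (p := (FT d n p.1, FT d n p.2))] at hp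
  rw [mem_graph_hamiltonian01 hM, ← mem_graph_mulOp (p := (FT d n q.1, FT d n q.2))] at hq
  have h := isSymm_mulOp _ _ hp _ hq
  simpa using h

theorem mem_graph_hamiltonian02 {p : Hilb d n × Hilb d n} :
    p ∈ (hamiltonian02 (d := d) (n := n) ħ mf).graph ↔
      ∀ᵐ x, (p.1 x, p.2 x) ∈ (secondQuant (d := d) ħ (dispersion mf)).graph :=
  mem_graph_fibreOp

/-- The graph of `Ĥ₀₂` in terms of one bounded operator on the values, which the Fourier transform
commutes with. -/
theorem mem_graph_hamiltonian02_iff_resolvent {p : Hilb d n × Hilb d n} :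
    p ∈ (hamiltonian02 (d := d) (n := n) ħ mf).graph ↔
      p.1 = (resolvent d ħ mf one_ne_zero 0).compLpL 2 volume (p.2 + Complex.I • p.1) := by
  rw [mem_graph_hamiltonian02]
  have h1 := (resolvent d ħ mf one_ne_zero 0).coeFn_compLpL (p.2 + Complex.I • p.1)
  have h2 := Lp.coeFn_add p.2 (Complex.I • p.1)
  have h3 := Lp.coeFn_smul Complex.I p.1
  constructor
  · intro h
    apply Lp.ext
    filter_upwards [h, h1, h2, h3] with x h h1 h2 h3
    rw [h1, h2, Pi.add_apply, h3]
    exact mem_graph_iff_eq_resolvent.1 h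
  · intro h
    rw [← h] at h1
    filter_upwards [h1, h2, h3] with x h1 h2 h3
    rw [h2, Pi.add_apply, h3] at h1
    exact mem_graph_iff_eq_resolvent.2 h1

/-- The field energy commutes with the Fourier transform in `X`. -/
theorem fourier_mem_graph_hamiltonian02 {p : Hilb d n × Hilb d n} :
    (FT d n p.1, FT d n p.2) ∈ (hamiltonian02 (d := d) (n := n) ħ mf).graph ↔
      p ∈ (hamiltonian02 (d := d) (n := n) ħ mf).graph := by
  rw [mem_graph_hamiltonian02_iff_resolvent, mem_graph_hamiltonian02_iff_resolvent]
  simp only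
  rw [← map_smul, ← map_add, ← fourier_compLpL]
  exact (FT d n).injective.eq_iff

theorem isSymm_hamiltonian0 (hM : ∀ j, 0 < M j) :
    IsSymm (hamiltonian0 (d := d) (n := n) ħ mf c M) :=
  (isSymm_hamiltonian01 hM).add (isSymm_fibreOp fun _ => isSymm_secondQuant)

/-- The free Hamiltonian dominates the field energy, since the kinetic energy is nonnegative and
commutes with it. -/
theorem norm_hamiltonian02_le (hħ : 0 < ħ) (hM : ∀ j, 0 < M j) {ψ a b : Hilb d n}
    (ha : (ψ, a) ∈ (hamiltonian01 (d := d) (n := n) ħ c M).graph)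
    (hb : (ψ, b) ∈ (hamiltonian02 (d := d) (n := n) ħ mf).graph) : ‖b‖ ≤ ‖a + b‖ := by
  rw [mem_graph_hamiltonian01 hM] at ha
  rw [← fourier_mem_graph_hamiltonian02, mem_graph_hamiltonian02] at hb
  rw [← (FT d n).norm_map b, ← (FT d n).norm_map (a + b), map_add]
  refine Lp.norm_le_norm_of_ae_le ?_
  filter_upwards [ha, hb, Lp.coeFn_add (FT d n a) (FT d n b)] with ξ h1 h2 h3
  rw [h3, Pi.add_apply, h1]
  exact (norm_le_norm_add_smul hħ h2 (totalSymbol_nonneg hM ξ)).1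

/-- The resolvent `(h(ξ) + dΓ(ω) + iλ)⁻¹` at the point `ξ` of the Fourier side. -/
noncomputable def fibreResolvent (ħ mf : ℝ) (c : Fin n → Kinematics) (M : Fin n → ℝ) {l : ℝ}
    (hl : l ≠ 0) (ξ : Config d n) : Fock d →L[ℂ] Fock d :=
  resolvent d ħ mf hl (totalSymbol ħ c M ξ)

theorem fibreResolvent_mem_graph (hM : ∀ j, 0 < M j) {l : ℝ} (hl : l ≠ 0) (ξ : Config d n)
    (v : Fock d) :
    (fibreResolvent ħ mf c M hl ξ v, v - ((totalSymbol ħ c M ξ : ℝ) + l * Complex.I : ℂ) •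
      fibreResolvent ħ mf c M hl ξ v) ∈ (secondQuant (d := d) ħ (dispersion mf)).graph := by
  have h := resolvent_mem_graph (ħ := ħ) (mf := mf) hl (totalSymbol ħ c M ξ) v
  rwa [abs_of_nonneg (totalSymbol_nonneg hM ξ)] at h

theorem norm_fibreResolvent_apply_le {l : ℝ} (hl : l ≠ 0) (ξ : Config d n) (v : Fock d) :
    ‖fibreResolvent ħ mf c M hl ξ v‖ ≤ |l|⁻¹ * ‖v‖ :=
  (fibreResolvent ħ mf c M hl ξ).le_of_opNorm_le (norm_resolvent_le hl _) v

theorem norm_symbol_smul_fibreResolvent_le (hħ : 0 < ħ) (hM : ∀ j, 0 < M j) {l : ℝ} (hl : l ≠ 0)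
    (ξ : Config d n) (v : Fock d) :
    ‖(totalSymbol ħ c M ξ : ℂ) • fibreResolvent ħ mf c M hl ξ v‖ ≤ 2 * ‖v‖ := by
  have h0 := totalSymbol_nonneg (ħ := ħ) (c := c) hM ξ
  have h1 := (norm_le_norm_add_smul hħ (fibreResolvent_mem_graph (mf := mf) (c := c) hM hl ξ v) h0).2
  simp only at h1
  have h2 : (totalSymbol ħ c M ξ : ℂ) • fibreResolvent ħ mf c M hl ξ v +
      (v - ((totalSymbol ħ c M ξ : ℝ) + l * Complex.I : ℂ) • fibreResolvent ħ mf c M hl ξ v) =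
        v - (l * Complex.I : ℂ) • fibreResolvent ħ mf c M hl ξ v := by
    rw [add_smul]; abel
  have h3 : ‖(l * Complex.I : ℂ) • fibreResolvent ħ mf c M hl ξ v‖ ≤ ‖v‖ := by
    have h4 := norm_fibreResolvent_apply_le (ħ := ħ) (mf := mf) (c := c) (M := M) hl ξ v
    rw [norm_smul, norm_mul, Complex.norm_real, Complex.norm_I, mul_one, Real.norm_eq_abs]
    calc _ ≤ |l| * (|l|⁻¹ * ‖v‖) := by gcongr
      _ = ‖v‖ := by rw [← mul_assoc, mul_inv_cancel₀ (abs_ne_zero.2 hl), one_mul]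
  rw [norm_smul, Complex.norm_real, Real.norm_of_nonneg h0]
  refine h1.trans ?_
  rw [h2]
  exact (norm_sub_le _ _).trans (by linarith)

theorem memLp_fibreResolvent {l : ℝ} (hl : l ≠ 0) (φ : Hilb d n) :
    MemLp (fun ξ => fibreResolvent ħ mf c M hl ξ (φ ξ)) 2 volume := by
  have hRm : AEStronglyMeasurable (fibreResolvent (d := d) ħ mf c M hl) volume :=
    ((continuous_resolvent hl).comp continuous_totalSymbol).aestronglyMeasurable
  refine (Lp.memLp φ).of_le_mul (c := |l|⁻¹) ?_
    (Filter.Eventually.of_forall fun ξ => norm_fibreResolvent_apply_le hl ξ _)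
  exact (ContinuousLinearMap.id ℂ (Fock d →L[ℂ] Fock d)).aestronglyMeasurable_comp₂ hRm
    (Lp.aestronglyMeasurable _)

theorem memLp_symbol_smul_fibreResolvent (hħ : 0 < ħ) (hM : ∀ j, 0 < M j) {l : ℝ} (hl : l ≠ 0)
    (φ : Hilb d n) :
    MemLp (fun ξ => (totalSymbol ħ c M ξ : ℂ) • fibreResolvent ħ mf c M hl ξ (φ ξ)) 2 volume := by
  have hzm : AEStronglyMeasurable (fun ξ : Config d n => (totalSymbol ħ c M ξ : ℂ)) volume :=
    (Complex.continuous_ofReal.comp continuous_totalSymbol).aestronglyMeasurable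
  exact (Lp.memLp φ).of_le_mul (c := 2) (hzm.smul (memLp_fibreResolvent hl φ).1)
    (Filter.Eventually.of_forall fun ξ => norm_symbol_smul_fibreResolvent_le hħ hM hl ξ _)

/-- `Ĥ₀ + iλ` is onto: on the Fourier side its inverse is the fibrewise resolvent of the field
energy, shifted by the kinetic energy. -/
theorem hamiltonian0_surjective (hħ : 0 < ħ) (hM : ∀ j, 0 < M j) {l : ℝ} (hl : l ≠ 0)
    (φ : Hilb d n) :
    ∃ p ∈ (hamiltonian0 (d := d) (n := n) ħ mf c M).graph,
      p.2 + (l * Complex.I : ℂ) • p.1 = φ := by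
  obtain ⟨ψ, hψ⟩ := exists_symm_toLp (FT d n)
    (memLp_fibreResolvent (ħ := ħ) (mf := mf) (c := c) (M := M) hl (FT d n φ))
  obtain ⟨σ, hσ⟩ := exists_symm_toLp (FT d n)
    (memLp_symbol_smul_fibreResolvent (mf := mf) (c := c) hħ hM hl (FT d n φ))
  refine ⟨(ψ, φ - (l * Complex.I : ℂ) • ψ), mem_graph_add.2
    ⟨σ, φ - (l * Complex.I : ℂ) • ψ - σ, ?_, ?_, ?_⟩, ?_⟩
  · rw [mem_graph_hamiltonian01 hM]
    filter_upwards [hψ, hσ] with ξ h1 h2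
    rw [h1, h2]
  · rw [← fourier_mem_graph_hamiltonian02, mem_graph_hamiltonian02]
    simp only
    rw [map_sub, map_sub, map_smul]
    filter_upwards [hψ, hσ,
      Lp.coeFn_sub (FT d n φ - (l * Complex.I : ℂ) • FT d n ψ) (FT d n σ),
      Lp.coeFn_sub (FT d n φ) ((l * Complex.I : ℂ) • FT d n ψ),
      Lp.coeFn_smul (l * Complex.I : ℂ) (FT d n ψ)] with ξ h1 h2 h3 h4 h5
    rw [h3, Pi.sub_apply, h4, Pi.sub_apply, h5, Pi.smul_apply, h1, h2]
    have h6 := fibreResolvent_mem_graph (ħ := ħ) (mf := mf) (c := c) hM hl ξ (FT d n φ ξ)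
    rwa [add_smul, add_comm, ← sub_sub] at h6
  · simp only; abel
  · simp only; abel

end Free

/-! ### The coupling function -/

section Coupling

variable {d n : ℕ} {mf : ℝ} {χ : Space d → ℝ}

/-- The form factor `χ / √ω`. -/
noncomputable def formFactor (mf : ℝ) (χ : Space d → ℝ) (k : Space d) : ℝ :=
  χ k / √(dispersion mf k)

theorem memLp_formFactor (hχ : MemLp (fun k => dispersion mf k ^ (-(1 / 2) : ℝ) * χ k) 2 volume) :
    MemLp (formFactor mf χ) 2 volume := by
  refine hχ.ae_eq (Filter.Eventually.of_forall fun k => ?_)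
  change _ = χ k / √(dispersion mf k)
  rw [Real.rpow_neg (dispersion_nonneg k), ← Real.sqrt_eq_rpow]
  field_simp

theorem coupling_term_norm (x : Config d n) (k : Space d) (j : Fin n) :
    ‖((χ k / √(dispersion mf k) : ℝ) : ℂ) *
      Complex.exp (-2 * Real.pi * Complex.I * (⟪k, x j⟫_ℝ : ℂ))‖ = ‖formFactor mf χ k‖ := by
  rw [norm_mul, Complex.norm_real, Complex.norm_exp]
  simp [formFactor]

theorem norm_coupling_le (x : Config d n) (k : Space d) :
    ‖coupling mf χ x k‖ ≤ n * ‖formFactor mf χ k‖ := by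
  refine (norm_sum_le _ _).trans ?_
  simp only [coupling_term_norm]
  simp

theorem continuous_coupling (k : Space d) :
    Continuous fun x : Config d n => coupling mf χ x k := by
  unfold coupling
  fun_prop

theorem memLp_coupling (hu : MemLp (formFactor mf χ) 2 volume) (x : Config d n) :
    MemLp (coupling mf χ x) 2 volume := by
  refine hu.of_le_mul (c := n) ?_ (Filter.Eventually.of_forall (norm_coupling_le x))
  have h1 : AEStronglyMeasurable (fun k => ((formFactor mf χ k : ℝ) : ℂ)) volume :=
    Complex.continuous_ofReal.comp_aestronglyMeasurable hu.1
  refine Finset.aestronglyMeasurable_fun_sum _ fun j _ => h1.mul ?_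
  exact Continuous.aestronglyMeasurable (by fun_prop)

theorem l2norm_coupling_le (hu : MemLp (formFactor mf χ) 2 volume) (x : Config d n) :
    l2norm (coupling mf χ x) ≤ n * l2norm (formFactor mf χ) :=
  l2norm_le_mul (by positivity) hu (Filter.Eventually.of_forall (norm_coupling_le x))

/-- The coupling depends continuously on the configuration, as a square integrable function, by
dominated convergence. -/
theorem tendsto_l2norm_coupling_sub (hu : MemLp (formFactor mf χ) 2 volume) (x : Config d n) :
    Filter.Tendsto (fun y : Config d n => l2norm (coupling mf χ y - coupling mf χ x)) (nhds x)
      (nhds 0) := by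
  have hsq : Filter.Tendsto (fun y : Config d n => l2norm (coupling mf χ y - coupling mf χ x) ^ 2)
      (nhds x) (nhds 0) := by
    have e : ∀ y : Config d n, l2norm (coupling mf χ y - coupling mf χ x) ^ 2 =
        ∫ k, ‖coupling mf χ y k - coupling mf χ x k‖ ^ 2 := fun y =>
      l2norm_sq_eq_integral ((memLp_coupling hu y).sub (memLp_coupling hu x))
    simp only [e]
    have h := tendsto_integral_filter_of_dominated_convergence (μ := volume) (l := nhds x)
      (F := fun y k => ‖coupling mf χ y k - coupling mf χ x k‖ ^ 2) (f := fun _ => (0 : ℝ))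
      (fun k => (2 * n) ^ 2 * ‖formFactor mf χ k‖ ^ 2)
      (Filter.Eventually.of_forall fun y =>
        (((memLp_coupling hu y).sub (memLp_coupling hu x)).1.norm.pow 2))
      (Filter.Eventually.of_forall fun y => Filter.Eventually.of_forall fun k => ?_)
      ((hu.integrable_norm_pow two_ne_zero).const_mul _)
      (Filter.Eventually.of_forall fun k => ?_)
    · rwa [integral_zero] at h
    · rw [norm_pow, norm_norm, ← mul_pow]
      refine pow_le_pow_left₀ (norm_nonneg _) ((norm_sub_le _ _).trans ?_) 2
      linarith [norm_coupling_le (mf := mf) (χ := χ) y k, norm_coupling_le (mf := mf) (χ := χ) x k]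
    · have h1 : Continuous fun y : Config d n => ‖coupling mf χ y k - coupling mf χ x k‖ ^ 2 :=
        (((continuous_coupling k).sub continuous_const).norm.pow 2)
      simpa using h1.tendsto x
  have h2 := (Real.continuous_sqrt.tendsto 0).comp hsq
  rw [Real.sqrt_zero] at h2
  refine h2.congr fun y => ?_
  exact Real.sqrt_sq (l2norm_nonneg _ _)

end Coupling

/-! ### The interaction -/

section Interaction

variable {d n : ℕ} {ħ mf : ℝ} {χ : Space d → ℝ}
  {A : (Space d → ℂ) → Fock d →ₗ.[ℂ] Fock d}

/-- The constant in the bound of a field operator times `(dΓ(ω) + i)⁻¹`. -/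
noncomputable def fieldConst (ħ mf : ℝ) : ℝ := √(4 + (ħ + 1 / (4 * 1 * mf ^ 2)))

theorem fieldConst_nonneg : 0 ≤ fieldConst ħ mf := Real.sqrt_nonneg _

/-- A field operator times the resolvent `(dΓ(ω) + i)⁻¹` is bounded, with norm controlled by the
form factor. -/
theorem IsFieldOperator.norm_le_resolvent (hA : IsFieldOperator ħ mf A) (hħ : 0 < ħ)
    {g : Space d → ℂ} (hg : MemLp g 2) {v η : Fock d}
    (hη : (resolvent d ħ mf one_ne_zero 0 v, η) ∈ (A g).graph) :
    ‖η‖ ≤ l2norm g * fieldConst ħ mf * ‖v‖ := by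
  have hp := resolvent_mem_graph (d := d) (ħ := ħ) (mf := mf) one_ne_zero 0 v
  have h1 := hA.bound hg hp hη (ε := 1) (by norm_num)
  have hC : 0 ≤ ħ + 1 / (4 * 1 * mf ^ 2) := by positivity
  have h2 : ‖resolvent d ħ mf one_ne_zero 0 v‖ ≤ ‖v‖ := by
    have := (resolvent d ħ mf one_ne_zero 0).le_of_opNorm_le (norm_resolvent_le one_ne_zero 0) v
    simpa using this
  have h3 : ‖v - ((|0| : ℝ) + (1 : ℝ) * Complex.I : ℂ) • resolvent d ħ mf one_ne_zero 0 v‖ ≤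
      2 * ‖v‖ := by
    refine (norm_sub_le _ _).trans ?_
    rw [norm_smul]
    simp
    linarith
  have h4 := mul_le_mul_of_nonneg_left (pow_le_pow_left₀ (norm_nonneg _) h2 2) hC
  have h5 : 1 * ‖v - ((|0| : ℝ) + (1 : ℝ) * Complex.I : ℂ) •
      resolvent d ħ mf one_ne_zero 0 v‖ ^ 2 ≤ 4 * ‖v‖ ^ 2 := by
    rw [one_mul]
    refine (pow_le_pow_left₀ (norm_nonneg _) h3 2).trans_eq ?_
    ring
  refine abs_le_of_sq_le_sq' ?_ (mul_nonneg (mul_nonneg (l2norm_nonneg _ _)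
    fieldConst_nonneg) (norm_nonneg _)) |>.2
  rw [mul_pow, mul_pow, fieldConst, Real.sq_sqrt (by positivity), mul_assoc, add_mul]
  exact h1.trans (mul_le_mul_of_nonneg_left (add_le_add h5 h4) (sq_nonneg _))

/-- A field operator times `(dΓ(ω) + i)⁻¹`, as a bounded operator. -/
theorem IsFieldOperator.exists_clm (hA : IsFieldOperator ħ mf A) (hħ : 0 < ħ)
    {g : Space d → ℂ} (hg : MemLp g 2) :
    ∃ L : Fock d →L[ℂ] Fock d, ‖L‖ ≤ l2norm g * fieldConst ħ mf ∧
      ∀ v, (resolvent d ħ mf one_ne_zero 0 v, L v) ∈ (A g).graph := by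
  have hex : ∀ v : Fock d, ∃ η, (resolvent d ħ mf one_ne_zero 0 v, η) ∈ (A g).graph := fun v =>
    hA.exists_mem hg (resolvent_mem_graph (d := d) (ħ := ħ) (mf := mf) one_ne_zero 0 v)
  choose η hη using hex
  have hadd : ∀ v w, η (v + w) = η v + η w := by
    intro v w
    have h := (A g).graph.add_mem (hη v) (hη w)
    rw [Prod.mk_add_mk, ← map_add] at h
    exact LinearPMap.mem_graph_snd_inj _ (hη (v + w)) h rfl
  have hsmul : ∀ (a : ℂ) v, η (a • v) = a • η v := by
    intro a v
    have h := (A g).graph.smul_mem a (hη v)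
    rw [Prod.smul_mk, ← map_smul] at h
    exact LinearPMap.mem_graph_snd_inj _ (hη (a • v)) h rfl
  have hC : 0 ≤ l2norm g * fieldConst ħ mf := mul_nonneg (l2norm_nonneg _ _) fieldConst_nonneg
  let T : Fock d →ₗ[ℂ] Fock d := ⟨⟨η, hadd⟩, hsmul⟩
  have hT : ∀ v, ‖T v‖ ≤ l2norm g * fieldConst ħ mf * ‖v‖ := fun v =>
    hA.norm_le_resolvent hħ hg (hη v)
  exact ⟨T.mkContinuous _ hT, T.mkContinuous_norm_le hC hT, hη⟩

/-- The bounded operators `A(G_X) (dΓ(ω) + i)⁻¹` depend continuously on `X`. -/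
theorem IsFieldOperator.exists_continuous (hA : IsFieldOperator ħ mf A) (hħ : 0 < ħ)
    (hu : MemLp (formFactor mf χ) 2 volume) :
    ∃ L : Config d n → Fock d →L[ℂ] Fock d, Continuous L ∧ (∃ C, ∀ x, ‖L x‖ ≤ C) ∧
      ∀ x v, (resolvent d ħ mf one_ne_zero 0 v, L x v) ∈ (A (coupling mf χ x)).graph := by
  choose L hLn hL using fun x : Config d n => hA.exists_clm hħ (memLp_coupling hu x)
  refine ⟨L, ?_, ⟨n * l2norm (formFactor mf χ) * fieldConst ħ mf, fun x => ?_⟩, hL⟩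
  · rw [continuous_iff_continuousAt]
    intro x
    rw [ContinuousAt, tendsto_iff_norm_sub_tendsto_zero]
    have h0 := (tendsto_l2norm_coupling_sub hu x).mul_const (fieldConst ħ mf)
    rw [zero_mul] at h0
    refine squeeze_zero (fun _ => norm_nonneg _) (fun y => ?_) h0
    refine ContinuousLinearMap.opNorm_le_bound _
      (mul_nonneg (l2norm_nonneg _ _) fieldConst_nonneg) fun v => ?_
    exact hA.norm_le_resolvent hħ ((memLp_coupling hu y).sub (memLp_coupling hu x))
      (hA.sub_mem (hL y v) (hL x v))
  · exact (hLn x).trans (mul_le_mul_of_nonneg_right (l2norm_coupling_le hu x) fieldConst_nonneg)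

/-- The fibred field operator is defined on the domain of `Ĥ₀₂`. -/
theorem IsFieldOperator.exists_fibreOp_mem (hA : IsFieldOperator ħ mf A) (hħ : 0 < ħ)
    (hu : MemLp (formFactor mf χ) 2 volume) {p : Hilb d n × Hilb d n}
    (hp : p ∈ (hamiltonian02 (d := d) (n := n) ħ mf).graph) :
    ∃ η : Hilb d n, (p.1, η) ∈ (fibreOp volume fun x => A (coupling mf χ x)).graph := by
  obtain ⟨L, hLc, ⟨C, hC⟩, hL⟩ := hA.exists_continuous (n := n) hħ hu
  set w : Hilb d n := p.2 + Complex.I • p.1 with hw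
  have hmem : MemLp (fun x => L x (w x)) 2 volume := by
    refine (Lp.memLp w).of_le_mul (c := C) ?_
      (Filter.Eventually.of_forall fun x => (L x).le_of_opNorm_le (hC x) _)
    exact (ContinuousLinearMap.id ℂ (Fock d →L[ℂ] Fock d)).aestronglyMeasurable_comp₂
      hLc.aestronglyMeasurable (Lp.aestronglyMeasurable _)
  refine ⟨hmem.toLp _, mem_graph_fibreOp.2 ?_⟩
  rw [mem_graph_hamiltonian02] at hp
  filter_upwards [hp, hmem.coeFn_toLp, Lp.coeFn_add p.2 (Complex.I • p.1),
    Lp.coeFn_smul Complex.I p.1] with x h1 h2 h3 h4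
  have h5 := mem_graph_iff_eq_resolvent.1 h1
  have h6 := hL x (w x)
  rw [hw, h3, Pi.add_apply, h4, Pi.smul_apply, ← h5] at h6
  rw [h2, hw, h3, Pi.add_apply, h4, Pi.smul_apply]
  exact h6

/-- The fibred field operator is infinitesimally bounded with respect to `Ĥ₀₂`, since `δ > 0` is
arbitrary. -/
theorem IsFieldOperator.fibreOp_bound (hA : IsFieldOperator ħ mf A) (hħ : 0 < ħ)
    (hu : MemLp (formFactor mf χ) 2 volume) {p : Hilb d n × Hilb d n}
    (hp : p ∈ (hamiltonian02 (d := d) (n := n) ħ mf).graph) {η : Hilb d n}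
    (hη : (p.1, η) ∈ (fibreOp volume fun x => A (coupling mf χ x)).graph) {δ : ℝ} (hδ : 0 < δ) :
    ‖η‖ ≤ n * l2norm (formFactor mf χ) *
      (δ * ‖p.2‖ + √(ħ + 1 / (4 * δ ^ 2 * mf ^ 2)) * ‖p.1‖) := by
  set G : ℝ := n * l2norm (formFactor mf χ) with hG
  set C : ℝ := ħ + 1 / (4 * δ ^ 2 * mf ^ 2) with hC
  have hG0 : 0 ≤ G := mul_nonneg (Nat.cast_nonneg _) (l2norm_nonneg _ _)
  have hC0 : 0 ≤ C := by positivity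
  rw [mem_graph_hamiltonian02] at hp
  rw [mem_graph_fibreOp] at hη
  have h1 : ‖η‖ ^ 2 ≤ G ^ 2 * (δ ^ 2 * ‖p.2‖ ^ 2 + C * ‖p.1‖ ^ 2) := by
    rw [norm_sq_eq_integral, norm_sq_eq_integral, norm_sq_eq_integral, ← integral_const_mul,
      ← integral_const_mul, ← integral_add ((integrable_norm_sq _).const_mul _)
        ((integrable_norm_sq _).const_mul _), ← integral_const_mul]
    refine integral_mono_ae (integrable_norm_sq _) ((((integrable_norm_sq _).const_mul _).add
        ((integrable_norm_sq _).const_mul _)).const_mul _) ?_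
    filter_upwards [hp, hη] with x h1 h2
    refine (hA.bound (memLp_coupling hu x) h1 h2 (pow_pos hδ 2)).trans ?_
    refine mul_le_mul_of_nonneg_right ?_ (by positivity)
    exact pow_le_pow_left₀ (l2norm_nonneg _ _) (l2norm_coupling_le hu x) 2
  refine abs_le_of_sq_le_sq' (h1.trans ?_) (by positivity) |>.2
  rw [mul_pow G]
  refine mul_le_mul_of_nonneg_left ?_ (sq_nonneg G)
  have h2 := Real.sq_sqrt hC0
  have h3 : 0 ≤ δ * ‖p.2‖ * (√C * ‖p.1‖) := by positivity
  nlinarith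

theorem isSymm_hamiltonian1 (hħ : 0 < ħ) (hu : MemLp (formFactor mf χ) 2 volume) :
    IsSymm (hamiltonian1 (d := d) (n := n) ħ mf χ) := by
  have key : ∀ {ψ η φ ζ : Hilb d n},
      (ψ, η) ∈ (fibreOp volume fun x => creation ħ (coupling mf χ x)).graph →
      (φ, ζ) ∈ (fibreOp volume fun x => annihilation ħ (coupling mf χ x)).graph →
      ⟪η, φ⟫_ℂ = ⟪ψ, ζ⟫_ℂ := by
    intro ψ η φ ζ h h'
    rw [mem_graph_fibreOp] at h h'
    rw [L2.inner_def, L2.inner_def]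
    refine integral_congr_ae ?_
    filter_upwards [h, h'] with x h1 h2
    exact inner_creation_eq hħ (memLp_coupling hu x) h1 h2
  intro p hp q hq
  obtain ⟨a, b, ha, hb, hab⟩ := mem_graph_add.1 hp
  obtain ⟨a', b', ha', hb', hab'⟩ := mem_graph_add.1 hq
  rw [hab, hab', inner_add_left, inner_add_right, key hb ha', add_comm]
  congr 1
  rw [← inner_conj_symm, ← key hb' ha, inner_conj_symm]

end Interaction

/-! ### The Nelson Hamiltonian -/

section Main

variable {d n : ℕ} {ħ mf : ℝ} {c : Fin n → Kinematics} {M : Fin n → ℝ} {V : Config d n → ℝ}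
  {χ : Space d → ℝ}

theorem IsC2b.exists_bound {E : Type*} [NormedAddCommGroup E] [NormedSpace ℝ E] {V : E → ℝ}
    (hV : IsC2b V) : ∃ C, 0 ≤ C ∧ ∀ x, ‖V x‖ ≤ C := by
  obtain ⟨C, hC⟩ := hV.2 0 (by norm_num)
  simp only [norm_iteratedFDeriv_zero] at hC
  exact ⟨C, (norm_nonneg _).trans (hC 0), hC⟩

theorem mulOp_domain_eq_top (hV : Continuous V) {C : ℝ} (hC : ∀ x, ‖V x‖ ≤ C) :
    (mulOp (F := Fock d) volume V).domain = ⊤ := by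
  rw [eq_top_iff]
  intro ψ _
  have hVm : AEStronglyMeasurable (fun x => (V x : ℂ)) volume :=
    (Complex.continuous_ofReal.comp hV).aestronglyMeasurable
  have hmem : MemLp (fun x => (V x : ℂ) • ψ x) 2 volume := by
    refine (Lp.memLp ψ).of_le_mul (c := C) (hVm.smul (Lp.memLp ψ).1)
      (Filter.Eventually.of_forall fun x => ?_)
    rw [norm_smul, Complex.norm_real]
    exact mul_le_mul_of_nonneg_right (hC x) (norm_nonneg _)
  refine LinearPMap.mem_domain_iff.2 ⟨hmem.toLp _, mem_graph_mulOp.2 ?_⟩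
  exact hmem.coeFn_toLp

theorem norm_mulOp_le {C : ℝ} (hC : ∀ x, ‖V x‖ ≤ C) {p : Hilb d n × Hilb d n}
    (hp : p ∈ (mulOp volume V).graph) : ‖p.2‖ ≤ C * ‖p.1‖ := by
  rw [mem_graph_mulOp] at hp
  refine Lp.norm_le_mul_norm_of_ae_le_mul ?_
  filter_upwards [hp] with x hx
  rw [hx, norm_smul, Complex.norm_real]
  exact mul_le_mul_of_nonneg_right (hC x) (norm_nonneg _)

theorem hamiltonian_domain (hħ : 0 < ħ) (hmf : 0 < mf) (hV : IsC2b V)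
    (hu : MemLp (formFactor mf χ) 2 volume) :
    (hamiltonian (d := d) (n := n) ħ mf c M V χ).domain =
      (hamiltonian0 (d := d) (n := n) ħ mf c M).domain := by
  obtain ⟨C, -, hC⟩ := hV.exists_bound
  refine le_antisymm (fun ψ hψ => hψ.1.1) fun ψ hψ => ⟨⟨hψ, ?_⟩, ?_, ?_⟩
  · rw [mulOp_domain_eq_top hV.1.continuous hC]; trivial
  · obtain ⟨φ, hφ⟩ := LinearPMap.mem_domain_iff.1 hψ.2
    exact LinearPMap.mem_domain_iff.2
      ((isFieldOperator_annihilation hħ hmf).exists_fibreOp_mem hħ hu hφ)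
  · obtain ⟨φ, hφ⟩ := LinearPMap.mem_domain_iff.1 hψ.2
    exact LinearPMap.mem_domain_iff.2
      ((isFieldOperator_creation hħ hmf).exists_fibreOp_mem hħ hu hφ)

theorem isSymm_hamiltonian (hħ : 0 < ħ) (hM : ∀ j, 0 < M j)
    (hu : MemLp (formFactor mf χ) 2 volume) :
    IsSymm (hamiltonian (d := d) (n := n) ħ mf c M V χ) :=
  ((isSymm_hamiltonian0 hM).add (isSymm_mulOp V)).add (isSymm_hamiltonian1 hħ hu)

/-- The perturbation `V + Ĥ₁` has relative bound at most `1/2` with respect to `Ĥ₀`. -/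
theorem exists_relative_bound (hħ : 0 < ħ) (hmf : 0 < mf) (hM : ∀ j, 0 < M j) (hV : IsC2b V)
    (hu : MemLp (formFactor mf χ) 2 volume) :
    ∃ b : ℝ, 0 ≤ b ∧ ∀ x y z, (x, y) ∈ (hamiltonian0 (d := d) (n := n) ħ mf c M).graph →
      (x, z) ∈ (hamiltonian (d := d) (n := n) ħ mf c M V χ).graph →
      ‖z - y‖ ≤ 1 / 2 * ‖y‖ + b * ‖x‖ := by
  obtain ⟨C, hC0, hC⟩ := hV.exists_bound
  set G : ℝ := n * l2norm (formFactor mf χ) with hG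
  have hG0 : 0 ≤ G := mul_nonneg (Nat.cast_nonneg _) (l2norm_nonneg _ _)
  -- the two field operators together have relative bound `2 G δ`, which is at most `1/2`
  set δ : ℝ := 1 / (4 * G + 1) with hδ
  have hδ0 : 0 < δ := by positivity
  have hGδ : 2 * (G * δ) ≤ 1 / 2 := by
    rw [hδ, mul_one_div, mul_div_assoc', div_le_div_iff₀ (by positivity) two_pos]
    linarith
  set S : ℝ := √(ħ + 1 / (4 * δ ^ 2 * mf ^ 2)) with hS
  have hS0 : 0 ≤ S := Real.sqrt_nonneg _
  refine ⟨C + 2 * (G * S), by positivity, fun x y z hy hz => ?_⟩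
  obtain ⟨y₁, y₂, hy₁, hy₂, hyy⟩ := mem_graph_add.1 hy
  obtain ⟨u, w, hu', hw, huw⟩ := mem_graph_add.1 hz
  obtain ⟨y', v, hy', hv, hyv⟩ := mem_graph_add.1 hu'
  obtain ⟨a, a', ha, ha', haa⟩ := mem_graph_add.1 hw
  simp only at hyy huw hyv haa hy₁ hy₂ hy' hv ha ha'
  have e : y' = y := LinearPMap.mem_graph_snd_inj _ hy' hy rfl
  have h1 : ‖y₂‖ ≤ ‖y‖ := by rw [hyy]; exact norm_hamiltonian02_le hħ hM hy₁ hy₂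
  have h2 := norm_mulOp_le hC hv
  have h3 := (isFieldOperator_annihilation hħ hmf).fibreOp_bound hħ hu hy₂ ha hδ0
  have h4 := (isFieldOperator_creation hħ hmf).fibreOp_bound hħ hu hy₂ ha' hδ0
  simp only [← hG, ← hS] at h2 h3 h4
  have h5 : z - y = v + (a + a') := by rw [huw, hyv, haa, e]; abel
  have h6 : ‖z - y‖ ≤ ‖v‖ + (‖a‖ + ‖a'‖) := by
    rw [h5]
    exact (norm_add_le _ _).trans (by gcongr; exact norm_add_le _ _)
  have h7 : 2 * (G * δ) * ‖y₂‖ ≤ 1 / 2 * ‖y‖ := by gcongr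
  nlinarith

end Main

end Nelson

theorem mainTheorem5 (d n : ℕ) (hd : 0 < d)
    (ħ : ℝ) (hħ : 0 < ħ) (mf : ℝ) (hmf : 0 < mf)
    (c : Fin n → Nelson.Kinematics) (M : Fin n → ℝ) (hM : ∀ j, 0 < M j)
    (V : Nelson.Config d n → ℝ) (hV : Nelson.IsC2b V)
    (χ : Nelson.Space d → ℝ)
    (hχ : MemLp (fun k => Nelson.dispersion mf k ^ (-(1 / 2) : ℝ) * χ k) 2 volume) :
    IsSelfAdjoint (Nelson.hamiltonian (d := d) (n := n) ħ mf c M V χ) ∧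
    (Nelson.hamiltonian (d := d) (n := n) ħ mf c M V χ).domain =
      (Nelson.hamiltonian0 (d := d) (n := n) ħ mf c M).domain ∧
    (Nelson.hamiltonian0 (d := d) (n := n) ħ mf c M).domain =
      (Nelson.hamiltonian01 (d := d) (n := n) ħ c M).domain ⊓
        (Nelson.hamiltonian02 (d := d) (n := n) ħ mf).domain := by
  have hu := Nelson.memLp_formFactor hχ
  have hdom := Nelson.hamiltonian_domain (n := n) (c := c) (M := M) hħ hmf hV hu
  obtain ⟨b, hb, hbound⟩ := Nelson.exists_relative_bound (c := c) hħ hmf hM hV hu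
  exact ⟨(Nelson.isSymm_hamiltonian0 hM).isSelfAdjoint_of_relatively_bounded
    (fun l hl φ => Nelson.hamiltonian0_surjective hħ hM hl φ)
    (Nelson.isSymm_hamiltonian hħ hM hu) (by norm_num) (by norm_num) hb hdom.ge hbound, hdom, rfl⟩
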